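/- Let $\alpha>-1$. Put $h_\alpha(\sigma)=\frac{2^{\alpha+1}}{\Gamma(\alpha+1)}\sigma^{\alpha}e^{-2\sigma}$ for $\sigma>0$, $w_n=\int_0^\infty n^{-2\sigma}h_\alpha(\sigma)\,d\sigma=(1+\log n)^{-(\alpha+1)}$ for $n\ge1$, and $\beta_\alpha(\sigma)=\int_0^\sigma(\sigma-u)h_\alpha(u)\,du$. For $\theta\in\mathbb R$ let $\mathbb C_\theta=\{s\in\mathbb C:\Re s>\theta\}$ and $\mathbb C_+=\mathbb C_0$. Let $\mathcal A^2_\alpha$ be the Hilbert space of Dirichlet series $f(s)=\sum_{n\ge1}a_nn^{-s}$ with $\|f\|^2=\sum_{n\ge1}|a_n|^2w_n<\infty$; these series converge absolutely on $\mathbb C_{1/2}$. For an integer $c_0\ge0$, a $c_0$-symbol is an analytic function $\Phi:\mathbb C_{1/2}\to\mathbb C_{1/2}$ of the form $\Phi(s)=c_0s+\varphi(s)$, where $\varphi$ is represented in some half-plane by a convergent Dirichlet series $\sum_{n\ge1}c_nn^{-s}$, such that $C_\Phi f=f\circ\Phi$ defines a bounded operator on $\mathcal A^2_\alpha$. **Theorem.**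 Let $c_0\ge1$ and $l\ge1$ be integers and let $\Phi(s)=c_0s+\varphi(s)$ be a $c_0$-symbol whose coefficients satisfy $c_n=0$ whenever $n$ has a prime divisor larger than $l$. Then $\Phi$ extends to an analytic map $\mathbb C_+\to\mathbb C_+$ (again denoted by $\Phi$, with $\varphi(s)=\Phi(s)-c_0s$ on $\mathbb C_+$). If moreover $\operatorname{Im}\varphi$ is bounded on $\mathbb C_+$, then the following are equivalent: (i) $C_\Phi$ is compact on $\mathcal A^2_\alpha$; (ii) $\dfrac{\Re s}{\Re\Phi(s)}\to0$ as $\Re s\to0^+$, uniformly in $\operatorname{Im}s$; (iii) $N_{\alpha,\Phi}(s)=o\big((\Re s)^{\alpha+2}\big)$ as $\Re s\to0^+$, uniformly in $\operatorname{Im}s$, where $N_{\alpha,\Phi}(s)=\sum_{a\in\mathbb C_+,\ \Phi(a)=s}\beta_\alpha(\Re a)$ for $s\in\mathbb C_+$ (each preimage being counted once, and an empty sum being $0$). -/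

import Mathlib

open Filter Topology

noncomputable section

namespace DirichletBergman

/-- The open half-plane `{s : ℂ | θ < Re s}`. -/
def halfPlane (θ : ℝ) : Set ℂ := {s | θ < s.re}

/-- The density on `(0, ∞)` of the probability measure `μ_α`. -/
def density (α σ : ℝ) : ℝ :=
  2 ^ (α + 1) / Real.Gamma (α + 1) * σ ^ α * Real.exp (-2 * σ)

/-- The weight `w_n = (1 + log n) ^ (-(α + 1))`; by `integral_eq_weight` below it is the integral
of `n ^ (-2 σ)` against `μ_α`. -/
def weight (α : ℝ) (n : ℕ+) : ℝ := (1 + Real.log (n : ℝ)) ^ (-(α + 1))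

lemma one_add_log_pos (n : ℕ+) : 0 < 1 + Real.log (n : ℝ) := by
  have : 0 ≤ Real.log (n : ℝ) := Real.log_nonneg (by exact_mod_cast n.pos)
  linarith

lemma weight_pos (α : ℝ) (n : ℕ+) : 0 < weight α n :=
  Real.rpow_pos_of_pos (one_add_log_pos n) _

theorem integral_eq_weight {α : ℝ} (hα : -1 < α) (n : ℕ+) :
    ∫ σ in Set.Ioi (0 : ℝ), (n : ℝ) ^ (-2 * σ) * density α σ = weight α n := by
  have hL := one_add_log_pos n
  have hn : (0 : ℝ) < n := by exact_mod_cast n.pos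
  have hG : Real.Gamma (α + 1) ≠ 0 := (Real.Gamma_pos_of_pos (by linarith)).ne'
  have h1 : ∀ σ : ℝ, (n : ℝ) ^ (-2 * σ) * density α σ =
      2 ^ (α + 1) / Real.Gamma (α + 1) *
        (σ ^ (α + 1 - 1) * Real.exp (-((2 * (1 + Real.log (n : ℝ))) * σ))) := by
    intro σ
    rw [Real.rpow_def_of_pos hn, density, add_sub_cancel_right,
      show -((2 * (1 + Real.log (n : ℝ))) * σ) = Real.log n * (-2 * σ) + -2 * σ by ring,
      Real.exp_add]
    ring
  simp_rw [h1]
  rw [MeasureTheory.integral_const_mul,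
    Real.integral_rpow_mul_exp_neg_mul_Ioi (by linarith) (by positivity), weight,
    one_div, Real.inv_rpow (by positivity), Real.mul_rpow (by norm_num) hL.le,
    Real.rpow_neg hL.le]
  have h2 : (2 : ℝ) ^ (α + 1) ≠ 0 := (Real.rpow_pos_of_pos two_pos _).ne'
  field_simp

/-- Coefficient sequences `(a_n)` with `∑ |a_n|² w_n < ∞`. -/
def coeffSubmodule (α : ℝ) : Submodule ℂ (ℕ+ → ℂ) where
  carrier := {a | Summable fun n => ‖a n‖ ^ 2 * weight α n}
  zero_mem' := by simp
  add_mem' := by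
    intro a b ha hb
    refine Summable.of_nonneg_of_le
      (fun n => mul_nonneg (sq_nonneg _) (weight_pos α n).le) (fun n => ?_)
      ((ha.mul_left 2).add (hb.mul_left 2))
    have h := norm_add_le (a n) (b n)
    have h2 : ‖a n + b n‖ ^ 2 ≤ 2 * ‖a n‖ ^ 2 + 2 * ‖b n‖ ^ 2 := by
      nlinarith [norm_nonneg (a n + b n), sq_nonneg (‖a n‖ - ‖b n‖)]
    have h3 := mul_le_mul_of_nonneg_right h2 (weight_pos α n).le
    simp only [Pi.add_apply]
    linarith
  smul_mem' := by
    intro z a ha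
    refine (Summable.mul_left (‖z‖ ^ 2) ha).congr fun n => ?_
    simp only [Pi.smul_apply, smul_eq_mul, norm_mul]
    ring

/-- The space `𝒜²_α` of Dirichlet series `∑ a_n n^{-s}` with `∑ |a_n|² w_n < ∞`, given by their
coefficients, with norm `(∑ |a_n|² w_n)^{1/2}` (see `norm_sq_eq`). -/
def Space (α : ℝ) : Type := coeffSubmodule α

namespace Space

variable {α : ℝ}

instance : AddCommGroup (Space α) := inferInstanceAs (AddCommGroup (coeffSubmodule α))

instance : Module ℂ (Space α) := inferInstanceAs (Module ℂ (coeffSubmodule α))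

/-- The coefficients of an element of `𝒜²_α`. -/
def coeff (f : Space α) : ℕ+ → ℂ := f.1

lemma summable_coeff (f : Space α) : Summable fun n => ‖f.coeff n‖ ^ 2 * weight α n := f.2

lemma norm_sqrt_mul_sq (a : ℂ) (n : ℕ+) :
    ‖((√(weight α n) : ℝ) : ℂ) * a‖ ^ 2 = ‖a‖ ^ 2 * weight α n := by
  rw [norm_mul, Complex.norm_real, Real.norm_eq_abs, mul_pow, sq_abs,
    Real.sq_sqrt (weight_pos α n).le, mul_comm]

/-- The linear map `(a_n) ↦ (a_n √w_n)` into `ℓ²`, through which `𝒜²_α` is normed. -/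
def toL2 (α : ℝ) : Space α →ₗ[ℂ] lp (fun _ : ℕ+ => ℂ) 2 where
  toFun f := ⟨fun n => ((√(weight α n) : ℝ) : ℂ) * f.coeff n, by
    refine memℓp_gen ?_
    refine (summable_coeff f).congr fun n => ?_
    rw [← norm_sqrt_mul_sq]
    simp⟩
  map_add' f g := by
    ext n
    exact mul_add _ (f.coeff n) (g.coeff n)
  map_smul' z f := by
    ext n
    exact mul_left_comm _ z (f.coeff n)

lemma toL2_injective (α : ℝ) : Function.Injective (toL2 α) := by
  intro f g h
  refine Subtype.ext (funext fun n => ?_)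
  have h1 : ((√(weight α n) : ℝ) : ℂ) * f.coeff n = ((√(weight α n) : ℝ) : ℂ) * g.coeff n :=
    congrFun (congrArg Subtype.val h) n
  have h2 : ((√(weight α n) : ℝ) : ℂ) ≠ 0 :=
    Complex.ofReal_ne_zero.mpr (Real.sqrt_pos.mpr (weight_pos α n)).ne'
  exact mul_left_cancel₀ h2 h1

instance : NormedAddCommGroup (Space α) :=
  NormedAddCommGroup.induced (Space α) (lp (fun _ : ℕ+ => ℂ) 2) (toL2 α) (toL2_injective α)

instance : NormedSpace ℂ (Space α) :=
  NormedSpace.induced ℂ (Space α) (lp (fun _ : ℕ+ => ℂ) 2) (toL2 α)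

lemma norm_sq_eq (f : Space α) : ‖f‖ ^ 2 = ∑' n, ‖f.coeff n‖ ^ 2 * weight α n := by
  have h : ‖f‖ = ‖toL2 α f‖ := rfl
  have h2 := lp.norm_rpow_eq_tsum (p := 2) (by norm_num) (toL2 α f)
  simp only [ENNReal.toReal_ofNat, Real.rpow_ofNat] at h2
  rw [h, h2]
  exact tsum_congr fun n => norm_sqrt_mul_sq (f.coeff n) n

/-- The value `f(s) = ∑ a_n n^{-s}`; the series converges absolutely for `Re s > 1/2`. -/
def eval (f : Space α) (s : ℂ) : ℂ := ∑' n : ℕ+, f.coeff n * (n : ℂ) ^ (-s)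

end Space

/-- `T` is the composition operator `C_Φ : f ↦ f ∘ Φ` on `𝒜²_α`, the elements of `𝒜²_α` being
regarded as functions on `{Re s > 1/2}`. -/
def IsCompositionOperator (α : ℝ) (Φ : ℂ → ℂ) (T : Space α →L[ℂ] Space α) : Prop :=
  ∀ f : Space α, ∀ s ∈ halfPlane (1 / 2), (T f).eval s = f.eval (Φ s)

/-- In some half-plane the Dirichlet series `∑ c_n n^{-s}` converges, with sum `φ(s)`. The number
`σ₀` is taken at least `1/2` because `φ` is only given on `{Re s > 1/2}`. -/
def IsDirichletSeriesOf (c : ℕ+ → ℂ) (φ : ℂ → ℂ) : Prop :=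
  ∃ σ₀ : ℝ, 1 / 2 ≤ σ₀ ∧ ∀ s ∈ halfPlane σ₀,
    Tendsto (fun N : ℕ+ => ∑ n ∈ Finset.Icc 1 N, c n * (n : ℂ) ^ (-s)) atTop (𝓝 (φ s))

/-- `Φ` (of which only the values on `{Re s > 1/2}` matter) is a `c₀`-symbol for `𝒜²_α`, and `c` is
the coefficient sequence of the Dirichlet series `φ(s) = Φ(s) - c₀ s`. -/
structure IsSymbol (α : ℝ) (c₀ : ℕ) (c : ℕ+ → ℂ) (Φ : ℂ → ℂ) : Prop where
  analytic : DifferentiableOn ℂ Φ (halfPlane (1 / 2))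
  mapsTo : Set.MapsTo Φ (halfPlane (1 / 2)) (halfPlane (1 / 2))
  dirichlet : IsDirichletSeriesOf c fun s => Φ s - c₀ * s
  bounded : ∃ T : Space α →L[ℂ] Space α, IsCompositionOperator α Φ T

/-- `c_n = 0` as soon as `n` has a prime factor larger than `l`. -/
def SmoothSupported (l : ℕ) (c : ℕ+ → ℂ) : Prop :=
  ∀ n : ℕ+, (∃ p : ℕ, p.Prime ∧ p ∣ (n : ℕ) ∧ l < p) → c n = 0

/-- `C_Φ` is a compact operator on `𝒜²_α`. -/
def CompactComposition (α : ℝ) (Φ : ℂ → ℂ) : Prop :=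
  ∃ T : Space α →L[ℂ] Space α, IsCompositionOperator α Φ T ∧ IsCompactOperator T

/-- `β_α(σ) = ∫_0^σ (σ - u) dμ_α(u)`. -/
def beta (α σ : ℝ) : ℝ := ∫ u in (0 : ℝ)..σ, (σ - u) * density α u

/-- The generalized Nevanlinna counting function: the sum of `β_α(Re a)` over all `a` with
`Re a > 0` and `Φ(a) = s` (an empty sum is `0`). -/
def nevanlinna (α : ℝ) (Φ : ℂ → ℂ) (s : ℂ) : ENNReal :=
  ∑' a : {a : ℂ // a ∈ halfPlane 0 ∧ Φ a = s}, ENNReal.ofReal (beta α (a : ℂ).re)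

/-- The filter `Re s → 0⁺`, uniformly in `Im s`. -/
def reToZero : Filter ℂ := comap Complex.re (𝓝[>] 0)

end DirichletBergman

end

open Filter Topology

noncomputable section

namespace DirichletBergman

/-! Extension. Put `T = C_Φ`. Each `T(n^{-s}) = n^{-Φ}` is a Dirichlet series, and differentiating
it gives a recursion showing that for smooth `n` its coefficients live on smooth integers `m ≥
n^{c₀}`. Over smooth integers `∑ n^{-2σ}/w_n` is finite for every `σ > 0`, so `2^{-Φ}` and `3^{-Φ}`
continue to `ℂ₊`. A common relation between their logarithmic derivatives excludes zeros, because
`2^k = 3^m` has no nontrivial solution; hence `Φ` continues as a logarithm (`exists_extension`).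
Testing on `2^j` gives `Re Φ(s) ≥ c₀ Re s` (`mul_re_le_re`).

(i) ⇒ (ii). Let `K(σ)` be the squared norm of point evaluation on the smooth subspace. Compactness
tested on reproducing kernels gives `√K(Re Φ(s)) ≤ C + ε √K(Re s)`. Since `K` is doubling and blows
up at `0`, `Re Φ(s)` cannot stay comparable to `Re s` (`tendsto_of_isCompactOperator`).

(ii) ⇒ (i). If `Re Φ ≥ η` on the line `Re s = σ`, then the mean square of `f ∘ Φ` on that line is at
most the mean square of `f` on `Re s = η`: compare `|f|²` with its harmonic extension from `Re w =
η`, whose mean along the image of the line is found by contour integration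
(`sum_coeff_map_poly_sq_le`). Integrating in `σ` makes `T` small on series without early terms, so
`T` is a norm limit of finite rank operators.

(ii) ⇔ (iii). `β_α(σ)` is comparable to `σ^{α+2}` near `0`. A single preimage gives (iii) ⇒ (ii).
Conversely (ii) makes each `Re a` small against `Re s`, which handles `α + 1` of the powers, and a
Littlewood inequality `∑ Re a = O(Re s)`, from Blaschke factors, handles the last one
(`nevanlinna_le_of_tendsto`). Only this last step uses that `Im φ` is bounded. -/

/-! ### Smooth integers and the weights of point evaluation -/

/-- The positive integers without prime factors `≥ N`. -/
def smoothSet (N : ℕ) : Set ℕ+ := {n | (n : ℕ) ∈ N.smoothNumbers}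

/-- The squared modulus `n ^ (-2 σ) / w_n` of the `n`-th coefficient of point evaluation. -/
def kern (α σ : ℝ) (n : ℕ+) : ℝ := (n : ℝ) ^ (-2 * σ) * (weight α n)⁻¹

lemma natCast_pos (n : ℕ+) : (0 : ℝ) < n := by exact_mod_cast n.pos

lemma one_le_natCast (n : ℕ+) : (1 : ℝ) ≤ n := by exact_mod_cast n.pos

lemma inv_weight (α : ℝ) (n : ℕ+) : (weight α n)⁻¹ = (1 + Real.log (n : ℝ)) ^ (α + 1) := by
  rw [weight, Real.rpow_neg (one_add_log_pos n).le, inv_inv]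

lemma kern_nonneg (α σ : ℝ) (n : ℕ+) : 0 ≤ kern α σ n :=
  mul_nonneg (Real.rpow_nonneg (natCast_pos n).le _) (inv_nonneg.2 (weight_pos α n).le)

lemma kern_indicator_nonneg (α σ : ℝ) (S : Set ℕ+) (n : ℕ+) : 0 ≤ S.indicator (kern α σ) n :=
  Set.indicator_nonneg (fun n _ => kern_nonneg α σ n) n

lemma exists_inv_weight_le {α : ℝ} (hα : -1 < α) {ε : ℝ} (hε : 0 < ε) :
    ∃ C, 0 < C ∧ ∀ n : ℕ+, (weight α n)⁻¹ ≤ C * (n : ℝ) ^ ε := by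
  have ha : 0 < α + 1 := by linarith
  set δ := ε / (α + 1) with hδ
  have hδ0 : 0 < δ := by positivity
  refine ⟨(1 + 1 / δ) ^ (α + 1), by positivity, fun n => ?_⟩
  have h1 : 1 + Real.log (n : ℝ) ≤ (1 + 1 / δ) * (n : ℝ) ^ δ := by
    have := Real.log_le_rpow_div (natCast_pos n).le hδ0
    have h2 : 1 ≤ (n : ℝ) ^ δ := Real.one_le_rpow (one_le_natCast n) hδ0.le
    calc _ ≤ (n : ℝ) ^ δ + (n : ℝ) ^ δ / δ := add_le_add h2 this
      _ = _ := by ring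
  rw [inv_weight]
  calc _ ≤ ((1 + 1 / δ) * (n : ℝ) ^ δ) ^ (α + 1) :=
        Real.rpow_le_rpow (one_add_log_pos n).le h1 ha.le
    _ = _ := by
        rw [Real.mul_rpow (by positivity) (Real.rpow_nonneg (natCast_pos n).le _),
          ← Real.rpow_mul (natCast_pos n).le, hδ, div_mul_cancel₀ _ ha.ne']

lemma exists_kern_le {α : ℝ} (hα : -1 < α) {τ σ : ℝ} (h : τ < σ) :
    ∃ C, 0 < C ∧ ∀ n : ℕ+, kern α σ n ≤ C * (n : ℝ) ^ (-2 * τ) := by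
  obtain ⟨C, hC, hn⟩ := exists_inv_weight_le hα (ε := 2 * (σ - τ)) (by linarith)
  refine ⟨C, hC, fun n => ?_⟩
  calc kern α σ n ≤ (n : ℝ) ^ (-2 * σ) * (C * (n : ℝ) ^ (2 * (σ - τ))) :=
        mul_le_mul_of_nonneg_left (hn n) (Real.rpow_nonneg (natCast_pos n).le _)
    _ = C * (n : ℝ) ^ (-2 * τ) := by
        rw [mul_left_comm, ← Real.rpow_add (natCast_pos n)]
        ring_nf

/-- A finite Euler product of convergent geometric series. This is what lets smooth-supported series
converge on all of `ℂ₊` instead of only on `ℂ_{1/2}`. -/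
lemma summable_smoothSet_rpow (N : ℕ) {ε : ℝ} (hε : 0 < ε) :
    Summable ((smoothSet N).indicator fun n : ℕ+ => (n : ℝ) ^ (-ε)) := by
  let f : ℕ →* ℝ :=
    { toFun := fun n => (n : ℝ) ^ (-ε)
      map_one' := by simp
      map_mul' := fun m n => by
        rw [Nat.cast_mul, Real.mul_rpow m.cast_nonneg n.cast_nonneg] }
  have h := (EulerProduct.summable_and_hasSum_smoothNumbers_prod_primesBelow_geometric (f := f)
    (fun {p} hp => by
      have hp1 : (1 : ℝ) < p := by exact_mod_cast hp.one_lt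
      change ‖(p : ℝ) ^ (-ε)‖ < 1
      rw [Real.norm_of_nonneg (Real.rpow_nonneg (by linarith) _)]
      exact Real.rpow_lt_one_of_one_lt_of_neg hp1 (by linarith)) N).1
  rw [← summable_subtype_iff_indicator]
  let i : smoothSet N → N.smoothNumbers := fun n => ⟨((n : ℕ+) : ℕ), n.2⟩
  have hi : Function.Injective i := fun a b hab =>
    Subtype.ext (PNat.coe_injective (congrArg (fun z : N.smoothNumbers => (z : ℕ)) hab))
  refine (h.comp_injective hi).congr fun n => ?_
  change ‖((((n : ℕ+) : ℕ) : ℝ) ^ (-ε))‖ = _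
  rw [Real.norm_of_nonneg (Real.rpow_nonneg (natCast_pos _).le _)]
  rfl

lemma summable_kern_smoothSet {α : ℝ} (hα : -1 < α) (N : ℕ) {σ : ℝ} (hσ : 0 < σ) :
    Summable ((smoothSet N).indicator (kern α σ)) := by
  obtain ⟨C, hC, h⟩ := exists_kern_le hα (half_lt_self hσ)
  refine Summable.of_nonneg_of_le (kern_indicator_nonneg α σ _) (fun n => ?_)
    ((summable_smoothSet_rpow N hσ).mul_left C)
  by_cases hn : n ∈ smoothSet N
  · rw [Set.indicator_of_mem hn, Set.indicator_of_mem hn]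
    refine (h n).trans_eq ?_
    ring_nf
  · simp [hn]

lemma summable_kern_univ {α : ℝ} (hα : -1 < α) {σ : ℝ} (hσ : 1 / 2 < σ) :
    Summable ((Set.univ : Set ℕ+).indicator (kern α σ)) := by
  obtain ⟨C, hC, h⟩ := exists_kern_le hα (τ := (σ + 1 / 2) / 2) (σ := σ) (by linarith)
  rw [Set.indicator_univ]
  refine Summable.of_nonneg_of_le (kern_nonneg α σ) h (Summable.mul_left C ?_)
  exact (Real.summable_nat_rpow.2 (by linarith)).comp_injective PNat.coe_injective

/-! ### Evaluation, monomials and Dirichlet polynomials -/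

namespace Space

variable {α : ℝ}

@[ext] lemma ext {f g : Space α} (h : ∀ n, f.coeff n = g.coeff n) : f = g :=
  Subtype.ext (funext h)

@[simp] lemma coeff_smul (z : ℂ) (f : Space α) (n : ℕ+) : (z • f).coeff n = z * f.coeff n := rfl

@[simp] lemma coeff_zero (n : ℕ+) : (0 : Space α).coeff n = 0 := rfl

@[simp] lemma coeff_sub (f g : Space α) (n : ℕ+) : (f - g).coeff n = f.coeff n - g.coeff n := rfl

/-- The `n`-th coefficient as a linear functional. -/
def coeffₗ (n : ℕ+) : Space α →ₗ[ℂ] ℂ where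
  toFun f := f.coeff n
  map_add' _ _ := rfl
  map_smul' _ _ := rfl

lemma coeff_sum {ι : Type*} (F : Finset ι) (g : ι → Space α) (n : ℕ+) :
    (∑ i ∈ F, g i).coeff n = ∑ i ∈ F, (g i).coeff n :=
  map_sum (coeffₗ n) g F

lemma norm_coeff_sq_le (f : Space α) (n : ℕ+) : ‖f.coeff n‖ ^ 2 * weight α n ≤ ‖f‖ ^ 2 := by
  rw [norm_sq_eq]
  exact f.summable_coeff.le_tsum n fun m _ => mul_nonneg (sq_nonneg _) (weight_pos α m).le

lemma norm_mul_cpow (a : ℂ) (n : ℕ+) (s : ℂ) :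
    ‖a * (n : ℂ) ^ (-s)‖ = ‖a‖ * (n : ℝ) ^ (-s.re) := by
  rw [norm_mul]
  have : ((n : ℕ) : ℂ) = ((n : ℝ) : ℂ) := by push_cast; rfl
  rw [this, Complex.norm_cpow_eq_rpow_re_of_pos (natCast_pos n), Complex.neg_re]

/-- Cauchy–Schwarz for `a_n n^{-s} = (a_n √w_n)(n^{-s}/√w_n)`. The second factor may be cut down to
`S` for free; a small `S` gives convergence further left and sharper bounds. -/
lemma summable_norm_and_norm_eval_le {S : Set ℕ+} {f : Space α} {s : ℂ}
    (hf : ∀ n, f.coeff n ≠ 0 → n ∈ S) (hS : Summable (S.indicator (kern α s.re))) :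
    Summable (fun n => ‖f.coeff n * (n : ℂ) ^ (-s)‖) ∧
      ‖f.eval s‖ ≤ ‖f‖ * √(∑' n, S.indicator (kern α s.re) n) := by
  set x : ℕ+ → ℝ := fun n => ‖f.coeff n‖ * √(weight α n)
  set y : ℕ+ → ℝ := fun n => √(S.indicator (kern α s.re) n)
  have hx2 : ∀ n, x n ^ (2 : ℝ) = ‖f.coeff n‖ ^ 2 * weight α n := fun n => by
    rw [Real.rpow_two, mul_pow, Real.sq_sqrt (weight_pos α n).le]
  have hy2 : ∀ n, y n ^ (2 : ℝ) = S.indicator (kern α s.re) n := fun n => by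
    rw [Real.rpow_two, Real.sq_sqrt (kern_indicator_nonneg α _ S n)]
  have hxy : ∀ n, x n * y n = ‖f.coeff n * (n : ℂ) ^ (-s)‖ := fun n => by
    rw [norm_mul_cpow]
    by_cases h0 : f.coeff n = 0
    · simp [x, h0]
    · simp only [x, y, Set.indicator_of_mem (hf n h0), kern]
      have hw := weight_pos α n
      rw [Real.sqrt_mul (Real.rpow_nonneg (natCast_pos n).le _), Real.sqrt_inv,
        show -2 * s.re = -s.re * 2 by ring, Real.rpow_mul (natCast_pos n).le, Real.rpow_two,
        Real.sqrt_sq (Real.rpow_nonneg (natCast_pos n).le _)]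
      have : √(weight α n) ≠ 0 := (Real.sqrt_pos.2 hw).ne'
      field_simp
  have h := Real.summable_and_inner_le_Lp_mul_Lq_tsum_of_nonneg (f := x) (g := y) (p := 2) (q := 2)
    (Real.HolderConjugate.two_two) (fun n => by positivity) (fun n => by positivity)
    (f.summable_coeff.congr fun n => (hx2 n).symm) (hS.congr fun n => (hy2 n).symm)
  simp_rw [hxy, hx2, hy2] at h
  refine ⟨h.1, (norm_tsum_le_tsum_norm h.1).trans (h.2.trans_eq ?_)⟩
  rw [← norm_sq_eq, ← Real.sqrt_eq_rpow, ← Real.sqrt_eq_rpow, Real.sqrt_sq (norm_nonneg f)]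

lemma summable_of_half_lt (hα : -1 < α) (f : Space α) {s : ℂ} (hs : 1 / 2 < s.re) :
    Summable fun n => ‖f.coeff n * (n : ℂ) ^ (-s)‖ :=
  (summable_norm_and_norm_eval_le (S := Set.univ) (fun _ _ => trivial)
    (summable_kern_univ hα hs)).1

lemma summable_of_smooth (hα : -1 < α) {N : ℕ} {f : Space α}
    (hf : ∀ n, f.coeff n ≠ 0 → n ∈ smoothSet N) {s : ℂ} (hs : 0 < s.re) :
    Summable fun n => ‖f.coeff n * (n : ℂ) ^ (-s)‖ :=
  (summable_norm_and_norm_eval_le hf (summable_kern_smoothSet hα N hs)).1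

/-- The element `n ^ (-s)` of `𝒜²_α`. -/
def monomial (α : ℝ) (n : ℕ+) : Space α :=
  ⟨Pi.single n 1, by
    refine summable_of_ne_finset_zero (s := {n}) fun m hm => ?_
    rw [Finset.mem_singleton] at hm
    simp [hm]⟩

lemma coeff_monomial (n m : ℕ+) : (monomial α n).coeff m = if m = n then 1 else 0 := by
  change (Pi.single n 1 : ℕ+ → ℂ) m = _
  rw [Pi.single_apply]

lemma eval_monomial (n : ℕ+) (s : ℂ) : (monomial α n).eval s = (n : ℂ) ^ (-s) := by
  rw [eval, tsum_eq_single n]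
  · simp [coeff_monomial]
  · intro m hm
    simp [coeff_monomial, hm]

lemma norm_sq_monomial (n : ℕ+) : ‖monomial α n‖ ^ 2 = weight α n := by
  rw [norm_sq_eq, tsum_eq_single n]
  · simp [coeff_monomial]
  · intro m hm
    simp [coeff_monomial, hm]

/-- The Dirichlet polynomial `∑_{n ∈ F} a_n n ^ (-s)`. -/
def poly (α : ℝ) (F : Finset ℕ+) (a : ℕ+ → ℂ) : Space α := ∑ n ∈ F, a n • monomial α n

lemma coeff_poly (F : Finset ℕ+) (a : ℕ+ → ℂ) (n : ℕ+) :
    (poly α F a).coeff n = if n ∈ F then a n else 0 := by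
  rw [poly, coeff_sum]
  simp [coeff_monomial]

lemma norm_sq_poly (F : Finset ℕ+) (a : ℕ+ → ℂ) :
    ‖poly α F a‖ ^ 2 = ∑ n ∈ F, ‖a n‖ ^ 2 * weight α n := by
  rw [norm_sq_eq, tsum_eq_sum (s := F)]
  · exact Finset.sum_congr rfl fun n hn => by rw [coeff_poly, if_pos hn]
  · intro n hn
    simp [coeff_poly, hn]

lemma eval_sum {ι : Type*} (F : Finset ι) (z : ι → ℂ) (g : ι → Space α) {s : ℂ}
    (h : ∀ i ∈ F, Summable fun n => ‖(g i).coeff n * (n : ℂ) ^ (-s)‖) :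
    (∑ i ∈ F, z i • g i).eval s = ∑ i ∈ F, z i * (g i).eval s := by
  simp_rw [eval, coeff_sum, coeff_smul, Finset.sum_mul, mul_assoc]
  rw [Summable.tsum_finsetSum fun i hi => ((h i hi).of_norm).mul_left _]
  exact Finset.sum_congr rfl fun i hi => tsum_mul_left

/-- The coefficients as a function on `ℕ`. -/
def natCoeff (a : ℕ+ → ℂ) : ℕ → ℂ := Function.extend (fun n : ℕ+ => (n : ℕ)) a 0

@[simp] lemma natCoeff_coe (a : ℕ+ → ℂ) (n : ℕ+) : natCoeff a n = a n :=
  PNat.coe_injective.extend_apply a 0 n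

lemma term_natCoeff (a : ℕ+ → ℂ) (s : ℂ) :
    LSeries.term (natCoeff a) s =
      Function.extend (fun n : ℕ+ => (n : ℕ)) (fun n : ℕ+ => a n * (n : ℂ) ^ (-s)) 0 := by
  funext n
  rcases Nat.eq_zero_or_pos n with rfl | hn
  · rw [LSeries.term_zero, Function.extend_apply' _ _ _ (by rintro ⟨m, hm⟩; exact m.ne_zero hm)]
    rfl
  · lift n to ℕ+ using hn
    rw [PNat.coe_injective.extend_apply, LSeries.term_of_ne_zero n.ne_zero, natCoeff_coe,
      Complex.cpow_neg, div_eq_mul_inv]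

lemma lseriesSummable_natCoeff {a : ℕ+ → ℂ} {s : ℂ} :
    LSeriesSummable (natCoeff a) s ↔ Summable fun n : ℕ+ => ‖a n * (n : ℂ) ^ (-s)‖ := by
  rw [LSeriesSummable, term_natCoeff, summable_norm_iff]
  exact summable_extend_zero PNat.coe_injective

lemma lseries_natCoeff (a : ℕ+ → ℂ) (s : ℂ) :
    LSeries (natCoeff a) s = ∑' n : ℕ+, a n * (n : ℂ) ^ (-s) := by
  rw [LSeries, term_natCoeff]
  exact tsum_extend_zero PNat.coe_injective _

lemma differentiableOn_eval {f : Space α} {θ : ℝ}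
    (h : ∀ s : ℂ, θ < s.re → Summable fun n => ‖f.coeff n * (n : ℂ) ^ (-s)‖) :
    DifferentiableOn ℂ f.eval (halfPlane θ) := by
  have h1 : LSeries.abscissaOfAbsConv (natCoeff f.coeff) ≤ θ :=
    LSeries.abscissaOfAbsConv_le_of_forall_lt_LSeriesSummable fun y hy =>
      lseriesSummable_natCoeff.2 (h y (by simpa using hy))
  have h2 : f.eval = LSeries (natCoeff f.coeff) := funext fun s => (lseries_natCoeff _ s).symm
  rw [h2]
  refine (LSeries_differentiableOn _).mono fun s hs => ?_
  exact h1.trans_lt (by exact_mod_cast hs)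

end Space

/-! ### The Dirichlet coefficients of `n^{-Φ}` -/

lemma isOpen_halfPlane (θ : ℝ) : IsOpen (halfPlane θ) :=
  isOpen_lt continuous_const Complex.continuous_re

lemma convex_halfPlane (θ : ℝ) : Convex ℝ (halfPlane θ) := convex_halfSpace_re_gt θ

open Space

lemma sum_Icc_succPNat (g : ℕ+ → ℂ) (k : ℕ) :
    ∑ n ∈ Finset.Icc 1 k.succPNat, g n = ∑ i ∈ Finset.range (k + 1), g i.succPNat := by
  refine Finset.sum_nbij' (fun n => n.natPred) Nat.succPNat ?_ ?_ ?_ ?_ ?_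
  · intro n hn
    have h : (n : ℕ) ≤ k + 1 := by exact_mod_cast (Finset.mem_Icc.1 hn).2
    have := n.natPred_add_one
    simp only [Finset.mem_range]
    omega
  · intro i hi
    rw [Finset.mem_range] at hi
    exact Finset.mem_Icc.2 ⟨one_le, Nat.succPNat_le_succPNat.2 (by omega)⟩
  · intro n _
    exact PNat.succPNat_natPred n
  · intro i _
    exact Nat.natPred_succPNat i
  · intro n _
    rw [PNat.succPNat_natPred]

lemma tendsto_succPNat : Tendsto Nat.succPNat atTop atTop :=
  tendsto_atTop.2 fun b => eventually_atTop.2 ⟨b, fun a ha => by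
    rw [← PNat.coe_le_coe, Nat.succPNat_coe]; omega⟩

/-- A Dirichlet series that converges in some half-plane converges absolutely in some smaller
half-plane. -/
lemma exists_lseries_eq {c : ℕ+ → ℂ} {φ : ℂ → ℂ} (h : IsDirichletSeriesOf c φ) :
    ∃ X : ℝ, 1 / 2 < X ∧ ∀ s : ℂ, X < s.re →
      LSeriesSummable (natCoeff c) s ∧ LSeries (natCoeff c) s = φ s := by
  obtain ⟨σ₀, hσ₀, h⟩ := h
  have key : ∀ s ∈ halfPlane σ₀, Tendsto (fun k => ∑ i ∈ Finset.range k,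
      c i.succPNat * (i.succPNat : ℂ) ^ (-s)) atTop (𝓝 (φ s)) := fun s hs => by
    rw [← tendsto_add_atTop_iff_nat 1]
    refine ((h s hs).comp tendsto_succPNat).congr fun k => ?_
    exact sum_Icc_succPNat (fun n => c n * (n : ℂ) ^ (-s)) k
  have h1 := key ((σ₀ + 1 : ℝ) : ℂ) (by simp [halfPlane])
  have h2 : Tendsto (fun i : ℕ => c i.succPNat * (i.succPNat : ℂ) ^ (-((σ₀ + 1 : ℝ) : ℂ)))
      atTop (𝓝 0) := by
    have := ((tendsto_add_atTop_iff_nat 1).2 h1).sub h1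
    rw [sub_self] at this
    refine this.congr fun k => ?_
    rw [Finset.sum_range_succ, add_sub_cancel_left]
  obtain ⟨K, hK⟩ := (Metric.isBounded_range_of_tendsto _ h2).exists_norm_le
  -- The terms at the point `σ₀ + 1` tend to zero, so `c_n = O(n^{σ₀+1})`; this gives absolute
  -- convergence beyond `σ₀ + 2`.
  have hb : ∀ n : ℕ, n ≠ 0 → ‖natCoeff c n‖ ≤ K * (n : ℝ) ^ (σ₀ + 2 - 1) := by
    intro n hn
    obtain ⟨i, rfl⟩ := Nat.exists_eq_succ_of_ne_zero hn
    have h3 := hK _ ⟨i, rfl⟩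
    simp only [norm_mul_cpow, Complex.ofReal_re] at h3
    have h4 : natCoeff c i.succ = c i.succPNat := natCoeff_coe c i.succPNat
    rw [h4]
    have h5 := natCast_pos i.succPNat
    rw [Nat.succPNat_coe] at h3 h5
    rw [Real.rpow_neg h5.le, ← div_eq_mul_inv, div_le_iff₀ (Real.rpow_pos_of_pos h5 _)] at h3
    rwa [show σ₀ + 2 - 1 = σ₀ + 1 by ring]
  refine ⟨σ₀ + 2, by linarith, fun s hs => ?_⟩
  have hsum : LSeriesSummable (natCoeff c) s :=
    LSeriesSummable_of_le_const_mul_rpow hs ⟨K, hb⟩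
  refine ⟨hsum, ?_⟩
  have h3 := hsum.hasSum.tendsto_sum_nat
  have h4 := (tendsto_add_atTop_iff_nat 1).2 h3
  refine tendsto_nhds_unique (h4.congr fun k => ?_) (key s (lt_trans (by linarith) hs))
  rw [Finset.sum_range_succ', LSeries.term_zero, add_zero]
  refine Finset.sum_congr rfl fun i _ => ?_
  rw [LSeries.term_of_ne_zero (Nat.succ_ne_zero i), Complex.cpow_neg, div_eq_mul_inv]
  congr 1
  exact natCoeff_coe c i.succPNat

lemma eval_map_monomial {α : ℝ} {Φ : ℂ → ℂ} {T : Space α →L[ℂ] Space α}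
    (hT : IsCompositionOperator α Φ T) (n : ℕ+) {s : ℂ} (hs : 1 / 2 < s.re) :
    (T (monomial α n)).eval s = (n : ℂ) ^ (-Φ s) := by
  rw [hT _ s hs, eval_monomial]

open LSeries in
open scoped LSeries.notation in
/-- The recursion for the coefficients of `C_Φ n^{-s} = n^{-Φ(s)}`. -/
lemma log_mul_coeff_map_monomial {α : ℝ} (hα : -1 < α) {c₀ : ℕ} {c : ℕ+ → ℂ} {Φ : ℂ → ℂ}
    (hφ : IsDirichletSeriesOf c fun s => Φ s - c₀ * s)
    {T : Space α →L[ℂ] Space α} (hT : IsCompositionOperator α Φ T) (n : ℕ+) {m : ℕ} (hm : m ≠ 0) :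
    Complex.log m * natCoeff (T (monomial α n)).coeff m +
        Complex.log n * (logMul (natCoeff c) ⍟ natCoeff (T (monomial α n)).coeff) m =
      Complex.log n * c₀ * natCoeff (T (monomial α n)).coeff m := by
  obtain ⟨X, hX, hc⟩ := exists_lseries_eq hφ
  set a := natCoeff (T (monomial α n)).coeff with ha
  set b := natCoeff c with hb
  have hsa : ∀ s : ℂ, 1 / 2 < s.re → LSeriesSummable a s := fun s hs =>
    lseriesSummable_natCoeff.2 (summable_of_half_lt hα _ hs)
  have habs : ∀ s : ℂ, 1 / 2 < s.re → abscissaOfAbsConv a < s.re := fun s hs =>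
    (abscissaOfAbsConv_le_of_forall_lt_LSeriesSummable (x := 1 / 2)
      fun y hy => hsa _ (by simpa using hy)).trans_lt (by exact_mod_cast hs)
  have hbabs : ∀ s : ℂ, X < s.re → abscissaOfAbsConv b < s.re := fun s hs =>
    (abscissaOfAbsConv_le_of_forall_lt_LSeriesSummable (x := X)
      fun y hy => (hc _ (by simpa using hy)).1).trans_lt (by exact_mod_cast hs)
  have hn0 : (n : ℂ) ≠ 0 := by exact_mod_cast n.ne_zero
  have hA : ∀ s : ℂ, 1 / 2 < s.re → LSeries a s = (n : ℂ) ^ (-Φ s) := fun s hs => by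
    rw [← eval_map_monomial hT n hs]
    exact lseries_natCoeff _ s
  -- With `A(s) = n^{-Φ(s)}` this is `A' = -(log n) Φ' A`, both derivatives being written as
  -- Dirichlet series with coefficients multiplied by `-log`.
  have hder : ∀ s : ℂ, X < s.re →
      LSeries (logMul a) s + Complex.log n * (LSeries (logMul b) s * LSeries a s) =
        Complex.log n * c₀ * LSeries a s := fun s hs => by
    have h1 := LSeries_hasDerivAt (habs s (hX.trans hs))
    have h2 : HasDerivAt Φ (c₀ + -LSeries (logMul b) s) s := by
      have := ((hasDerivAt_id s).const_mul (c₀ : ℂ)).add (LSeries_hasDerivAt (hbabs s hs))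
      rw [mul_one] at this
      refine this.congr_of_eventuallyEq ?_
      filter_upwards [(isOpen_halfPlane X).mem_nhds hs] with z hz
      simp only [Pi.add_apply, id, (hc z hz).2]
      ring
    have h3 := h2.neg.const_cpow (c := (n : ℂ)) (Or.inl hn0)
    have h4 := h3.congr_of_eventuallyEq (f₁ := LSeries a) (by
      filter_upwards [(isOpen_halfPlane X).mem_nhds hs] with z hz
      simp only [hA z (hX.trans hz), Pi.neg_apply])
    have h5 := h1.unique h4
    simp only [Pi.neg_apply] at h5
    rw [← hA s (hX.trans hs)] at h5
    linear_combination -h5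
  have hs1 : ∀ s : ℂ, X < s.re → LSeriesSummable (logMul a) s := fun s hs =>
    LSeriesSummable_logMul_of_lt_re (habs s (hX.trans hs))
  have hs2 : ∀ s : ℂ, X < s.re → LSeriesSummable (logMul b) s := fun s hs =>
    LSeriesSummable_logMul_of_lt_re (hbabs s hs)
  have hs3 : ∀ s : ℂ, X < s.re → LSeriesSummable (Complex.log n • (logMul b ⍟ a)) s :=
    fun s hs => ((hs2 s hs).convolution (hsa s (hX.trans hs))).smul _
  have hlt : ∀ {f : ℕ → ℂ}, LSeriesSummable f ((X + 1 : ℝ) : ℂ) → abscissaOfAbsConv f < ⊤ :=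
    fun h => h.abscissaOfAbsConv_le.trans_lt (EReal.coe_lt_top _)
  have hX1 : X < ((X + 1 : ℝ) : ℂ).re := by simp
  -- Uniqueness of Dirichlet coefficients turns the differential equation into the recursion.
  have := eq_of_LSeries_eventually_eq (f := logMul a + Complex.log n • (logMul b ⍟ a))
    (g := (Complex.log n * c₀) • a) (hlt ((hs1 _ hX1).add (hs3 _ hX1)))
    (hlt ((hsa _ (hX.trans hX1)).smul _)) (by
      filter_upwards [eventually_gt_atTop X] with x hx
      have hx' : X < (x : ℂ).re := by simpa using hx
      rw [LSeries_add (hs1 _ hx') (hs3 _ hx'), LSeries_smul, LSeries_smul,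
        LSeries_convolution' (hs2 _ hx') (hsa _ (hX.trans hx'))]
      exact hder _ hx') hm
  simpa [logMul] using this

/-- Strong induction on `m`. For `m ≠ n^{c₀}` the factor `log m - c₀ log n` is nonzero, so the
recursion expresses the `m`-th coefficient through products `c_d a_k log d` with `dk = m`. The term
`d = 1` drops out since `log 1 = 0`; hence some `k < m` has `a_k ≠ 0` and `c_d ≠ 0`, and both
smoothness and the lower bound pass from `k` to `m`. -/
theorem mem_smoothSet_of_coeff_map_monomial_ne_zero {α : ℝ} (hα : -1 < α) {c₀ : ℕ}
    {c : ℕ+ → ℂ} {Φ : ℂ → ℂ} (hφ : IsDirichletSeriesOf c fun s => Φ s - c₀ * s)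
    {T : Space α →L[ℂ] Space α} (hT : IsCompositionOperator α Φ T) {N : ℕ}
    (hc : ∀ d, c d ≠ 0 → d ∈ smoothSet N) {n : ℕ+} (hn : n ∈ smoothSet N) (m : ℕ+)
    (hm : (T (monomial α n)).coeff m ≠ 0) : m ∈ smoothSet N ∧ n ^ c₀ ≤ m := by
  induction m using PNat.strongInductionOn with
  | _ m ih =>
  by_cases hmn : m = n ^ c₀
  · refine ⟨?_, hmn.ge⟩
    rw [hmn]
    change ((n ^ c₀ : ℕ+) : ℕ) ∈ N.smoothNumbers
    rw [PNat.pow_coe]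
    exact Nat.mem_smoothNumbers'.2 fun p hp h => Nat.mem_smoothNumbers'.1 hn p hp
      (hp.dvd_of_dvd_pow h)
  have hrec := log_mul_coeff_map_monomial hα hφ hT n m.ne_zero
  rw [natCoeff_coe] at hrec
  have hlog : ∀ k : ℕ+, Complex.log (k : ℕ) = (Real.log (k : ℝ) : ℝ) := fun k => by
    rw [Complex.ofReal_log (natCast_pos k).le]; simp
  have hne : Complex.log m - c₀ * Complex.log n ≠ 0 := by
    rw [hlog, hlog]
    intro h
    have h1 : Real.log (m : ℝ) = Real.log ((n : ℝ) ^ c₀) := by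
      rw [Real.log_pow]
      exact_mod_cast sub_eq_zero.1 h
    have h2 := Real.log_injOn_pos (natCast_pos m) (pow_pos (natCast_pos n) c₀) h1
    exact hmn (PNat.coe_injective (by rw [PNat.pow_coe]; exact_mod_cast h2))
  have hconv : (LSeries.convolution (LSeries.logMul (natCoeff c))
      (natCoeff (T (monomial α n)).coeff)) m ≠ 0 := by
    intro h0
    rw [h0] at hrec
    exact mul_ne_zero hne hm (by linear_combination hrec)
  rw [LSeries.convolution_def] at hconv
  obtain ⟨⟨d, k⟩, hdk, hne'⟩ := Finset.exists_ne_zero_of_sum_ne_zero hconv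
  obtain ⟨hdk, -⟩ := Nat.mem_divisorsAntidiagonal.1 hdk
  simp only at hdk hne'
  have hd0 : 0 < d := Nat.pos_of_ne_zero fun h => m.ne_zero (by rw [← hdk, h, zero_mul])
  have hk0 : 0 < k := Nat.pos_of_ne_zero fun h => m.ne_zero (by rw [← hdk, h, mul_zero])
  lift d to ℕ+ using hd0
  lift k to ℕ+ using hk0
  rw [LSeries.logMul, natCoeff_coe, natCoeff_coe] at hne'
  have hc' : c d ≠ 0 := right_ne_zero_of_mul (left_ne_zero_of_mul hne')
  have hd1 : d ≠ 1 := by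
    rintro rfl
    simp at hne'
  have hmul : d * k = m := PNat.coe_injective (by rw [PNat.mul_coe, hdk])
  have hkm : k < m := by
    rw [← hmul]
    exact lt_mul_of_one_lt_left' k (lt_of_le_of_ne one_le hd1.symm)
  obtain ⟨h1, h2⟩ := ih k hkm (right_ne_zero_of_mul hne')
  refine ⟨?_, h2.trans hkm.le⟩
  change (m : ℕ) ∈ N.smoothNumbers
  rw [← hdk]
  exact Nat.mul_mem_smoothNumbers (hc d hc') h1

/-! ### Analytic continuation of the symbol to `ℂ₊` -/

lemma eqOn_halfPlane_zero {f g : ℂ → ℂ} (hf : DifferentiableOn ℂ f (halfPlane 0))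
    (hg : DifferentiableOn ℂ g (halfPlane 0)) (h : Set.EqOn f g (halfPlane (1 / 2))) :
    Set.EqOn f g (halfPlane 0) := by
  have h1 : (1 : ℂ) ∈ halfPlane (1 / 2) := by norm_num [halfPlane]
  exact (hf.analyticOnNhd (isOpen_halfPlane 0)).eqOn_of_preconnected_of_eventuallyEq
    (hg.analyticOnNhd (isOpen_halfPlane 0)) (convex_halfPlane 0).isPreconnected
    (z₀ := 1) (by simp [halfPlane]) (h.eventuallyEq_of_mem ((isOpen_halfPlane _).mem_nhds h1))

lemma halfPlane_half_subset : halfPlane (1 / 2) ⊆ halfPlane 0 := fun s hs =>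
  lt_trans (by norm_num) (show (1 / 2 : ℝ) < s.re from hs)

/-- If `F'/F` and `G'/G` are in the ratio `log 2 : log 3`, then `F` has no zeros. -/
lemma ne_zero_of_log_deriv_ratio {F G : ℂ → ℂ} {z₀ : ℂ} (hF : AnalyticAt ℂ F z₀)
    (hG : AnalyticAt ℂ G z₀) (hF0 : ¬ ∀ᶠ z in 𝓝 z₀, F z = 0) (hG0 : ¬ ∀ᶠ z in 𝓝 z₀, G z = 0)
    (h : ∀ᶠ z in 𝓝 z₀, (Real.log 2 : ℂ) * (deriv G z * F z) = Real.log 3 * (deriv F z * G z)) :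
    F z₀ ≠ 0 := by
  intro hz
  obtain ⟨m, f, hf, hf0, hFf⟩ := hF.exists_eventuallyEq_pow_smul_nonzero_iff.2 hF0
  obtain ⟨k, g, hg, hg0, hGg⟩ := hG.exists_eventuallyEq_pow_smul_nonzero_iff.2 hG0
  -- The extra factor `z - z₀` avoids the exponent `j - 1`, so that order `j = 0` needs no separate
  -- statement.
  have hder : ∀ {H p : ℂ → ℂ} {j : ℕ}, AnalyticAt ℂ p z₀ →
      (∀ᶠ z in 𝓝 z₀, H z = (z - z₀) ^ j • p z) →
      ∀ᶠ z in 𝓝 z₀, (z - z₀) * deriv H z = (z - z₀) ^ j * (j * p z + (z - z₀) * deriv p z) := by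
    intro H p j hp hH
    filter_upwards [hH.eventually_nhds, hp.eventually_analyticAt] with z h1 h2
    have h3 : HasDerivAt (fun z => (z - z₀) ^ j • p z) _ z :=
      (((hasDerivAt_id z).sub_const z₀).pow j).mul h2.differentiableAt.hasDerivAt
    rw [(h3.congr_of_eventuallyEq h1).deriv]
    rcases j with _ | j
    · simp
    · simp only [id, Nat.add_sub_cancel, mul_one, Pi.pow_apply]
      ring
  have h1 : ∀ᶠ z in 𝓝[≠] z₀, (Real.log 2 : ℂ) * ((k * g z + (z - z₀) * deriv g z) * f z) =
      Real.log 3 * ((m * f z + (z - z₀) * deriv f z) * g z) := by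
    have := (h.and (hFf.and hGg)).and ((hder hf hFf).and (hder hg hGg))
    filter_upwards [this.filter_mono nhdsWithin_le_nhds, self_mem_nhdsWithin]
      with z ⟨⟨h1, h2, h3⟩, h4, h5⟩ hne
    have hne' : z - z₀ ≠ 0 := sub_ne_zero.2 hne
    rw [smul_eq_mul] at h2 h3
    refine mul_left_cancel₀ (mul_ne_zero (pow_ne_zero m hne') (pow_ne_zero k hne')) ?_
    calc _ = (Real.log 2 : ℂ) * (((z - z₀) ^ k * (k * g z + (z - z₀) * deriv g z)) *
          ((z - z₀) ^ m * f z)) := by ring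
      _ = (z - z₀) * ((Real.log 2 : ℂ) * (deriv G z * F z)) := by rw [← h5, ← h2]; ring
      _ = Real.log 3 * (((z - z₀) * deriv F z) * G z) := by rw [h1]; ring
      _ = _ := by rw [h4, h3]; ring
  have hc : ∀ {p q : ℂ → ℂ} (j : ℕ) (r : ℝ), AnalyticAt ℂ p z₀ → AnalyticAt ℂ q z₀ →
      Tendsto (fun z => (r : ℂ) * ((j * p z + (z - z₀) * deriv p z) * q z)) (𝓝[≠] z₀)
        (𝓝 (r * ((j * p z₀ + (z₀ - z₀) * deriv p z₀) * q z₀))) := by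
    intro p q j r hp hq
    have h1 := hp.continuousAt
    have h2 := hq.continuousAt
    have h3 := hp.deriv.continuousAt
    have : ContinuousAt (fun z => (r : ℂ) * ((j * p z + (z - z₀) * deriv p z) * q z)) z₀ := by
      fun_prop
    exact this.tendsto.mono_left nhdsWithin_le_nhds
  -- Letting `z → z₀` leaves only the orders of vanishing: `k log 2 = m log 3`, that is `2^k = 3^m`,
  -- while `F z₀ = 0` forces `m ≥ 1`.
  have h2 := tendsto_nhds_unique_of_eventuallyEq (hc k _ hg hf) (hc m _ hf hg) h1
  have h3 : (Real.log 2 * k : ℝ) = Real.log 3 * m := by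
    have : ((Real.log 2 : ℂ) * k) * (f z₀ * g z₀) = (Real.log 3 * m) * (f z₀ * g z₀) := by
      linear_combination h2
    exact_mod_cast mul_right_cancel₀ (mul_ne_zero hf0 hg0) this
  have h4 : (2 : ℝ) ^ k = 3 ^ m := by
    refine Real.log_injOn_pos (by simp) (by simp) ?_
    rw [Real.log_pow, Real.log_pow]
    linarith
  have h5 : (2 : ℕ) ^ k = 3 ^ m := by exact_mod_cast h4
  have hm : m ≠ 0 := by
    rintro rfl
    have := hFf.self_of_nhds
    simp only [pow_zero, one_smul] at this
    exact hf0 (this ▸ hz)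
  have hk : k = 0 := by
    by_contra hk
    have h6 : 2 ∣ 3 ^ m := h5 ▸ dvd_pow_self 2 hk
    exact absurd (Nat.prime_two.dvd_of_dvd_pow h6) (by norm_num)
  rw [hk, pow_zero] at h5
  exact absurd h5.symm (Nat.one_lt_pow hm (by norm_num)).ne'

/-- A zero-free analytic function on a half-plane has an analytic logarithm. -/
lemma exists_differentiableOn_exp_eq {F : ℂ → ℂ} (hF : DifferentiableOn ℂ F (halfPlane 0))
    (h0 : ∀ s ∈ halfPlane 0, F s ≠ 0) :
    ∃ f : ℂ → ℂ, DifferentiableOn ℂ f (halfPlane 0) ∧ ∀ s ∈ halfPlane 0, Complex.exp (f s) = F s := by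
  have hne : (halfPlane 0).Nonempty := ⟨1, by simp [halfPlane]⟩
  have := (convex_halfPlane 0).contractibleSpace hne
  have hsc : IsSimplyConnected (halfPlane 0) := (inferInstance : SimplyConnectedSpace (halfPlane 0))
  obtain ⟨f, hfc, hf⟩ := Complex.exists_continuousOn_eqOn_exp_comp hsc (isOpen_halfPlane 0)
    hF.continuousOn (by rintro ⟨s, hs, h⟩; exact h0 s hs h)
  refine ⟨f, fun s hs => DifferentiableAt.differentiableWithinAt ?_, hf⟩
  have hnhds := (isOpen_halfPlane 0).mem_nhds hs
  -- Near `s` the continuous logarithm `f` equals this function, because `Im (f z - f s)` stays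
  -- within `(-π, π)`; so `f` is differentiable.
  have hd : DifferentiableAt ℂ (fun z => Complex.log (F z / F s) + f s) s := by
    refine DifferentiableAt.add_const _ (((hF.differentiableAt hnhds).div_const _).clog ?_)
    rw [div_self (h0 s hs)]
    exact Complex.one_mem_slitPlane
  refine hd.congr_of_eventuallyEq ?_
  have hcont : Tendsto (fun z => (f z - f s).im) (𝓝 s) (𝓝 0) := by
    have := (Complex.continuous_im.tendsto _).comp
      ((hfc.continuousAt hnhds).tendsto.sub_const (f s))
    rwa [sub_self, Complex.zero_im] at this
  filter_upwards [hnhds, hcont.eventually (Ioo_mem_nhds (neg_lt_zero.2 Real.pi_pos) Real.pi_pos)]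
    with z hz hzi
  have h1 : F z / F s = Complex.exp (f z - f s) := by
    rw [Complex.exp_sub]
    exact congrArg₂ _ (hf hz).symm (hf hs).symm
  rw [h1, Complex.log_exp hzi.1 hzi.2.le]
  ring

lemma differentiableOn_natCast_cpow {θ : ℝ} {Φ : ℂ → ℂ} (n : ℕ+)
    (h : DifferentiableOn ℂ Φ (halfPlane θ)) :
    DifferentiableOn ℂ (fun s => (n : ℂ) ^ (-Φ s)) (halfPlane θ) :=
  h.neg.const_cpow (Or.inl (by exact_mod_cast n.ne_zero))

/-- The hypotheses on the symbol and on the composition operator that are used for the extension to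
`{Re s > 0}`; the coefficients of `φ` live on the positive integers without prime factors `≥ N`. -/
structure IsSmoothSymbol (α : ℝ) (c₀ N : ℕ) (Φ : ℂ → ℂ) (T : Space α →L[ℂ] Space α) : Prop where
  neg_one_lt : -1 < α
  differentiableOn : DifferentiableOn ℂ Φ (halfPlane (1 / 2))
  isCompositionOperator : IsCompositionOperator α Φ T
  coeff_support : ∀ n ∈ smoothSet N, ∀ m, (T (monomial α n)).coeff m ≠ 0 →
    m ∈ smoothSet N ∧ n ^ c₀ ≤ m

namespace IsSmoothSymbol

variable {α : ℝ} {c₀ N : ℕ} {Φ Ψ : ℂ → ℂ} {T : Space α →L[ℂ] Space α}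

lemma summable (h : IsSmoothSymbol α c₀ N Φ T) {n : ℕ+} (hn : n ∈ smoothSet N) {s : ℂ}
    (hs : 0 < s.re) : Summable fun m => ‖(T (monomial α n)).coeff m * (m : ℂ) ^ (-s)‖ :=
  summable_of_smooth h.neg_one_lt (fun m hm => (h.coeff_support n hn m hm).1) hs

lemma differentiableOn_eval (h : IsSmoothSymbol α c₀ N Φ T) {n : ℕ+} (hn : n ∈ smoothSet N) :
    DifferentiableOn ℂ (T (monomial α n)).eval (halfPlane 0) :=
  Space.differentiableOn_eval fun _ hs => h.summable hn hs

lemma eval_map_monomial (h : IsSmoothSymbol α c₀ N Φ T)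
    (hΨ : DifferentiableOn ℂ Ψ (halfPlane 0)) (hΨΦ : Set.EqOn Ψ Φ (halfPlane (1 / 2)))
    {n : ℕ+} (hn : n ∈ smoothSet N) {s : ℂ} (hs : 0 < s.re) :
    (T (monomial α n)).eval s = (n : ℂ) ^ (-Ψ s) :=
  eqOn_halfPlane_zero (h.differentiableOn_eval hn) (differentiableOn_natCast_cpow n hΨ)
    (fun z hz => by
      simp only [hΨΦ hz]
      exact DirichletBergman.eval_map_monomial h.isCompositionOperator n hz) hs

lemma natCast_mem_smoothSet {n : ℕ+} (h : (n : ℕ) < N) : n ∈ smoothSet N :=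
  Nat.mem_smoothNumbers_of_lt n.pos h

/-- Where `F = 2^{-Φ}` and `G = 3^{-Φ}`, one has `log 2 · G'F = log 3 · F'G`; the identity theorem
carries this to `ℂ₊`, where it rules out zeros of `F`. The base `3` serves only this purpose: `Ψ` is
then read off from a logarithm of `F`. The bound on `N` makes `2` and `3` smooth. -/
theorem exists_extension (h : IsSmoothSymbol α c₀ N Φ T) (hN : 4 ≤ N) :
    ∃ Ψ : ℂ → ℂ, DifferentiableOn ℂ Ψ (halfPlane 0) ∧ Set.EqOn Ψ Φ (halfPlane (1 / 2)) := by
  have h2 : (2 : ℕ+) ∈ smoothSet N := natCast_mem_smoothSet (by simp; omega)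
  have h3 : (3 : ℕ+) ∈ smoothSet N := natCast_mem_smoothSet (by simp; omega)
  set F := (T (monomial α 2)).eval
  set G := (T (monomial α 3)).eval
  have hF : DifferentiableOn ℂ F (halfPlane 0) := h.differentiableOn_eval h2
  have hG : DifferentiableOn ℂ G (halfPlane 0) := h.differentiableOn_eval h3
  have hFΦ : ∀ s ∈ halfPlane (1 / 2), F s = (2 : ℂ) ^ (-Φ s) := fun s hs => by
    simpa using DirichletBergman.eval_map_monomial h.isCompositionOperator 2 hs
  have hGΦ : ∀ s ∈ halfPlane (1 / 2), G s = (3 : ℂ) ^ (-Φ s) := fun s hs => by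
    simpa using DirichletBergman.eval_map_monomial h.isCompositionOperator 3 hs
  have hd : ∀ {H : ℂ → ℂ} {a : ℂ}, a ≠ 0 → (∀ s ∈ halfPlane (1 / 2), H s = a ^ (-Φ s)) →
      ∀ s ∈ halfPlane (1 / 2), HasDerivAt H (H s * Complex.log a * -deriv Φ s) s := by
    intro H a ha hH s hs
    have hnhds := (isOpen_halfPlane (1 / 2)).mem_nhds hs
    have := (h.differentiableOn.differentiableAt hnhds).hasDerivAt.neg.const_cpow (Or.inl ha)
    simp only [Pi.neg_apply] at this
    rw [hH s hs]
    refine this.congr_of_eventuallyEq ?_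
    filter_upwards [hnhds] with z hz using hH z hz
  have hlog : ∀ a : ℝ, 0 ≤ a → (Real.log a : ℂ) = Complex.log (a : ℂ) := fun a ha =>
    Complex.ofReal_log ha
  have hratio : Set.EqOn (fun z => (Real.log 2 : ℂ) * (deriv G z * F z))
      (fun z => Real.log 3 * (deriv F z * G z)) (halfPlane 0) := by
    refine eqOn_halfPlane_zero ?_ ?_ fun s hs => ?_
    · exact ((hG.deriv (isOpen_halfPlane 0)).mul hF).const_mul _
    · exact ((hF.deriv (isOpen_halfPlane 0)).mul hG).const_mul _
    · simp only [(hd two_ne_zero hFΦ s hs).deriv, (hd three_ne_zero hGΦ s hs).deriv]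
      rw [hlog 2 (by norm_num), hlog 3 (by norm_num)]
      push_cast
      ring
  have h1 : (1 : ℂ) ∈ halfPlane (1 / 2) := by norm_num [halfPlane]
  have hnz : ∀ {H : ℂ → ℂ} {a : ℂ}, a ≠ 0 → DifferentiableOn ℂ H (halfPlane 0) →
      (∀ s ∈ halfPlane (1 / 2), H s = a ^ (-Φ s)) → ∀ s ∈ halfPlane 0,
      ¬ ∀ᶠ z in 𝓝 s, H z = 0 := by
    intro H a ha hH hHΦ s hs hev
    have := (hH.analyticOnNhd (isOpen_halfPlane 0)).eqOn_zero_of_preconnected_of_eventuallyEq_zero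
      (convex_halfPlane 0).isPreconnected hs hev (halfPlane_half_subset h1)
    rw [hHΦ 1 h1] at this
    exact ha ((Complex.cpow_eq_zero_iff _ _).1 this).1
  have hF0 : ∀ s ∈ halfPlane 0, F s ≠ 0 := fun s hs =>
    ne_zero_of_log_deriv_ratio (hF.analyticOnNhd (isOpen_halfPlane 0) s hs)
      (hG.analyticOnNhd (isOpen_halfPlane 0) s hs) (hnz two_ne_zero hF hFΦ s hs)
      (hnz three_ne_zero hG hGΦ s hs)
      (hratio.eventuallyEq_of_mem ((isOpen_halfPlane 0).mem_nhds hs))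
  obtain ⟨f, hf, hfF⟩ := exists_differentiableOn_exp_eq hF hF0
  have hl2 : Complex.log 2 ≠ 0 := by
    have := hlog 2 (by norm_num)
    push_cast at this
    rw [← this]
    exact_mod_cast (Real.log_pos one_lt_two).ne'
  -- The logarithm `f` of `F` and `-Φ log 2` differ by a constant on `ℂ_{1/2}`, which is evaluated
  -- at `s = 1`.
  refine ⟨fun s => (f 1 + Complex.log 2 * Φ 1 - f s) / Complex.log 2,
    (hf.const_sub _).div_const _, fun s hs => ?_⟩
  have hconst : f s + Complex.log 2 * Φ s = f 1 + Complex.log 2 * Φ 1 := by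
    refine (isOpen_halfPlane (1 / 2)).is_const_of_deriv_eq_zero
      (convex_halfPlane _).isPreconnected (f := fun s => f s + Complex.log 2 * Φ s)
      ((hf.mono halfPlane_half_subset).add (h.differentiableOn.const_mul _)) (fun z hz => ?_) hs h1
    have hz0 := halfPlane_half_subset hz
    have e1 := (hf.differentiableAt ((isOpen_halfPlane 0).mem_nhds hz0)).hasDerivAt
    have e2 := (h.differentiableOn.differentiableAt ((isOpen_halfPlane _).mem_nhds hz)).hasDerivAt
    have e3 := e1.cexp.congr_of_eventuallyEq (f₁ := F) (by
      filter_upwards [(isOpen_halfPlane 0).mem_nhds hz0] with w hw using (hfF w hw).symm)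
    have e4 := e3.unique (hd two_ne_zero hFΦ z hz)
    rw [hfF z hz0, mul_assoc] at e4
    have e5 := mul_left_cancel₀ (hF0 z hz0) e4
    have e6 := e1.add (e2.const_mul (Complex.log 2))
    refine e6.deriv.trans ?_
    rw [e5]
    simp
  simp only
  rw [← hconst]
  field_simp
  ring

/-- Test on `n = 2^j`, whose monomial has norm at most `1`. Since the image lives on `m ≥ n^{c₀}`,
splitting `Re s = τ + (Re s - τ)` in the evaluation bound extracts `n^{-c₀τ}` and leaves a sum
independent of `n`. Thus `n^{-Re Ψ(s)} ≤ ‖T‖ K n^{-c₀τ}` for all `j`, which forces `c₀τ ≤ Re Ψ(s)`;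
then `τ → Re s`. -/
lemma mul_re_le_re (h : IsSmoothSymbol α c₀ N Φ T) (hN : 4 ≤ N)
    (hΨ : DifferentiableOn ℂ Ψ (halfPlane 0)) (hΨΦ : Set.EqOn Ψ Φ (halfPlane (1 / 2)))
    {s : ℂ} (hs : 0 < s.re) : c₀ * s.re ≤ (Ψ s).re := by
  have key : ∀ τ ∈ Set.Ioo 0 s.re, c₀ * τ ≤ (Ψ s).re := by
    rintro τ ⟨hτ, hτs⟩
    set K := √(∑' m, (smoothSet N).indicator (kern α (s.re - τ)) m) with hK
    have hsum := summable_kern_smoothSet h.neg_one_lt N (sub_pos.2 hτs)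
    by_contra! hlt
    set r : ℝ := 2 ^ (c₀ * τ - (Ψ s).re) with hr
    have hr1 : 1 < r := Real.one_lt_rpow one_lt_two (by linarith)
    have hbound : ∀ j : ℕ, r ^ j ≤ ‖T‖ * K := by
      intro j
      set n : ℕ+ := 2 ^ j with hn
      have hnN : n ∈ smoothSet N := Nat.mem_smoothNumbers'.2 fun p hp hpn => by
        rw [hn, PNat.pow_coe] at hpn
        have := Nat.le_of_dvd (by norm_num) (hp.dvd_of_dvd_pow hpn)
        simp at this
        omega
      have hn2 : (n : ℝ) = 2 ^ j := by rw [hn, PNat.pow_coe]; simp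
      set S : Set ℕ+ := smoothSet N ∩ {m | n ^ c₀ ≤ m}
      set A : ℝ := (n : ℝ) ^ (-(c₀ * τ)) with hA
      have hA0 : 0 < A := Real.rpow_pos_of_pos (natCast_pos n) _
      have hle : ∀ m, S.indicator (kern α s.re) m ≤
          A ^ 2 * (smoothSet N).indicator (kern α (s.re - τ)) m := by
        intro m
        by_cases hm : m ∈ S
        · rw [Set.indicator_of_mem hm, Set.indicator_of_mem hm.1, kern, kern,
            show -2 * s.re = -2 * τ + -2 * (s.re - τ) by ring, Real.rpow_add (natCast_pos m),
            mul_assoc]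
          refine mul_le_mul_of_nonneg_right ?_ (kern_nonneg α _ m)
          have h1 : ((n : ℝ) ^ c₀) ≤ m := by
            have : ((n ^ c₀ : ℕ+) : ℕ) ≤ m := hm.2
            rw [PNat.pow_coe] at this
            exact_mod_cast this
          calc (m : ℝ) ^ (-2 * τ) ≤ ((n : ℝ) ^ c₀) ^ (-2 * τ) :=
                Real.rpow_le_rpow_of_nonpos (pow_pos (natCast_pos n) _) h1 (by linarith)
            _ = A ^ 2 := by
                rw [hA, ← Real.rpow_natCast, ← Real.rpow_natCast _ 2,
                  ← Real.rpow_mul (natCast_pos n).le, ← Real.rpow_mul (natCast_pos n).le]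
                congr 1
                push_cast
                ring
        · rw [Set.indicator_of_notMem hm]
          exact mul_nonneg (sq_nonneg _) (kern_indicator_nonneg _ _ _ _)
      have hS : Summable (S.indicator (kern α s.re)) :=
        Summable.of_nonneg_of_le (kern_indicator_nonneg _ _ _) hle (hsum.mul_left _)
      have h1 := (summable_norm_and_norm_eval_le (f := T (monomial α n)) (S := S)
        (fun m hm => h.coeff_support n hnN m hm) hS).2
      rw [h.eval_map_monomial hΨ hΨΦ hnN hs] at h1
      have h2 : ‖((n : ℕ) : ℂ) ^ (-Ψ s)‖ = (n : ℝ) ^ (-(Ψ s).re) := by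
        simpa using norm_mul_cpow 1 n (Ψ s)
      have h3 : √(∑' m, S.indicator (kern α s.re) m) ≤ A * K := by
        rw [hK, ← Real.sqrt_sq hA0.le, ← Real.sqrt_mul (sq_nonneg A)]
        refine Real.sqrt_le_sqrt ?_
        rw [← tsum_mul_left]
        exact hS.tsum_le_tsum hle (hsum.mul_left _)
      have h4 : ‖T (monomial α n)‖ ≤ ‖T‖ := by
        refine T.le_of_opNorm_le_of_le le_rfl ?_ |>.trans_eq (mul_one _)
        have := norm_sq_monomial (α := α) n
        have hw : weight α n ≤ 1 := Real.rpow_le_one_of_one_le_of_nonpos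
          (by have := Real.log_nonneg (one_le_natCast n); linarith)
          (by have := h.neg_one_lt; linarith)
        nlinarith [norm_nonneg (monomial α n)]
      have h5 : (n : ℝ) ^ (-(Ψ s).re) ≤ ‖T‖ * K * A := by
        rw [← h2]
        refine h1.trans ((mul_le_mul h4 h3 (Real.sqrt_nonneg _) (norm_nonneg _)).trans_eq ?_)
        ring
      rw [← div_le_iff₀ hA0] at h5
      refine le_trans (le_of_eq ?_) h5
      rw [hA, ← Real.rpow_sub (natCast_pos n), hn2, hr, ← Real.rpow_natCast,
        ← Real.rpow_natCast, ← Real.rpow_mul two_pos.le, ← Real.rpow_mul two_pos.le]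
      ring_nf
    obtain ⟨j, hj⟩ := pow_unbounded_of_one_lt (‖T‖ * K) hr1
    exact absurd (hbound j) hj.not_ge
  have ht : Tendsto (fun τ : ℝ => c₀ * τ) (𝓝[<] s.re) (𝓝 (c₀ * s.re)) :=
    (continuous_const.mul continuous_id).continuousAt.tendsto.mono_left nhdsWithin_le_nhds
  exact le_of_tendsto ht (by filter_upwards [Ioo_mem_nhdsLT hs] with τ hτ using key τ hτ)

end IsSmoothSymbol

/-! ### Compactness forces `Re s / Re Φ(s) → 0` -/

namespace Space

variable {α : ℝ}

lemma norm_sub_poly_coeff_sq (F : Finset ℕ+) (f : Space α) :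
    ‖f - poly α F f.coeff‖ ^ 2 = ‖f‖ ^ 2 - ∑ n ∈ F, ‖f.coeff n‖ ^ 2 * weight α n := by
  have h1 : ∑ n ∈ F, ‖f.coeff n‖ ^ 2 * weight α n =
      ∑' n, if n ∈ F then ‖f.coeff n‖ ^ 2 * weight α n else 0 := by
    rw [tsum_eq_sum (s := F) fun n hn => if_neg hn]
    exact Finset.sum_congr rfl fun n hn => (if_pos hn).symm
  rw [eq_sub_iff_add_eq, norm_sq_eq, norm_sq_eq, h1, ← Summable.tsum_add (summable_coeff _)
    (summable_of_ne_finset_zero (s := F) fun n hn => if_neg hn)]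
  refine tsum_congr fun n => ?_
  rw [coeff_sub, coeff_poly]
  split_ifs <;> simp

lemma norm_sub_poly_coeff_le (F : Finset ℕ+) (f : Space α) : ‖f - poly α F f.coeff‖ ≤ ‖f‖ := by
  refine abs_le_of_sq_le_sq' ?_ (norm_nonneg f) |>.2
  rw [norm_sub_poly_coeff_sq]
  have : 0 ≤ ∑ n ∈ F, ‖f.coeff n‖ ^ 2 * weight α n :=
    Finset.sum_nonneg fun n _ => mul_nonneg (sq_nonneg _) (weight_pos α n).le
  linarith

lemma tendsto_norm_sub_poly_coeff (f : Space α) :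
    Tendsto (fun F => ‖f - poly α F f.coeff‖) atTop (𝓝 0) := by
  have h : Tendsto (fun F => ‖f - poly α F f.coeff‖ ^ 2) atTop (𝓝 0) := by
    simp_rw [norm_sub_poly_coeff_sq]
    have := (f.summable_coeff.hasSum).const_sub (‖f‖ ^ 2)
    rwa [← norm_sq_eq, sub_self] at this
  have h2 := h.sqrt
  rw [Real.sqrt_zero] at h2
  exact h2.congr fun F => Real.sqrt_sq (norm_nonneg _)

lemma sub_poly_coeff_sub (F : Finset ℕ+) (f g : Space α) :
    f - poly α F f.coeff - (g - poly α F g.coeff) =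
      f - g - poly α F (f - g).coeff := by
  ext n
  simp only [coeff_sub, coeff_poly]
  split_ifs <;> ring

/-- The image of the unit ball has a finite `ε/2`-net. One `F` makes all tails of the net small, and
taking tails is a contraction. -/
lemma exists_finset_tail_le {T : Space α →L[ℂ] Space α} (hT : IsCompactOperator T) {ε : ℝ}
    (hε : 0 < ε) : ∃ F : Finset ℕ+, ∀ f, ‖T f - poly α F (T f).coeff‖ ≤ ε * ‖f‖ := by
  have hK : IsCompact (closure (T '' Metric.closedBall 0 1)) :=
    IsCompactOperator.isCompact_closure_image_closedBall (f := (T : Space α →ₗ[ℂ] Space α)) hT 1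
  obtain ⟨t, ht, hcover⟩ := Metric.totallyBounded_iff.1 hK.totallyBounded (ε / 2) (half_pos hε)
  have hev : ∀ᶠ F in atTop, ∀ y ∈ t, ‖y - poly α F y.coeff‖ < ε / 2 :=
    (ht.eventually_all).2 fun y _ =>
      (tendsto_norm_sub_poly_coeff y).eventually_lt_const (half_pos hε)
  obtain ⟨F, hF⟩ := hev.exists
  have hunit : ∀ f : Space α, ‖f‖ ≤ 1 → ‖T f - poly α F (T f).coeff‖ ≤ ε := fun f hf => by
    have h1 := hcover (subset_closure ⟨f, by simpa using hf, rfl⟩)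
    simp only [Set.mem_iUnion, Metric.mem_ball, dist_eq_norm, exists_prop] at h1
    obtain ⟨y, hy, hlt⟩ := h1
    have h2 := norm_sub_poly_coeff_le F (T f - y)
    rw [← sub_poly_coeff_sub] at h2
    have h3 := norm_le_norm_sub_add (T f - poly α F (T f).coeff) (y - poly α F y.coeff)
    linarith [hF y hy]
  refine ⟨F, fun f => ?_⟩
  rcases eq_or_ne f 0 with rfl | hf
  · have : poly α F (0 : Space α).coeff = 0 := by
      ext n
      simp [coeff_poly]
    simp [this]
  have hf' : 0 < ‖f‖ := norm_pos_iff.2 hf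
  have h1 := hunit (((‖f‖⁻¹ : ℝ) : ℂ) • f) (by
    rw [norm_smul, Complex.norm_real, norm_inv, norm_norm, inv_mul_cancel₀ hf'.ne'])
  have h2 : T (((‖f‖⁻¹ : ℝ) : ℂ) • f) - poly α F (T (((‖f‖⁻¹ : ℝ) : ℂ) • f)).coeff =
      ((‖f‖⁻¹ : ℝ) : ℂ) • (T f - poly α F (T f).coeff) := by
    ext n
    simp only [map_smul, coeff_sub, coeff_smul, coeff_poly]
    split_ifs <;> ring
  rw [h2, norm_smul, Complex.norm_real, norm_inv, norm_norm, inv_mul_le_iff₀ hf'] at h1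
  linarith

end Space

/-- The squared norm of point evaluation at `s`, `Re s = σ`, on the subspace of `𝒜²_α` with
coefficients supported on the positive integers without prime factors `≥ N`. -/
def kernSum (α : ℝ) (N : ℕ) (σ : ℝ) : ℝ := ∑' n, (smoothSet N).indicator (kern α σ) n

lemma kernSum_anti {α : ℝ} (hα : -1 < α) (N : ℕ) {σ τ : ℝ} (hσ : 0 < σ) (h : σ ≤ τ) :
    kernSum α N τ ≤ kernSum α N σ := by
  refine Summable.tsum_le_tsum (fun n => ?_) (summable_kern_smoothSet hα N (hσ.trans_le h))
    (summable_kern_smoothSet hα N hσ)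
  refine Set.indicator_le_indicator (mul_le_mul_of_nonneg_right ?_
    (inv_nonneg.2 (weight_pos α n).le))
  exact Real.rpow_le_rpow_of_exponent_le (one_le_natCast n) (by linarith)

lemma kernSum_nonneg (α : ℝ) (N : ℕ) (σ : ℝ) : 0 ≤ kernSum α N σ :=
  tsum_nonneg (kern_indicator_nonneg α σ _)

lemma kern_sq_mul_le {α : ℝ} (hα : -1 < α) {σ : ℝ} (hσ : 0 < σ) (m q : ℕ+) :
    kern α σ (m ^ 2 * q) ≤ (2 + Real.log (q : ℝ)) ^ (α + 1) * kern α (2 * σ) m := by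
  have hm := natCast_pos m
  have hq := natCast_pos q
  have hlm := Real.log_nonneg (one_le_natCast m)
  have hlq := Real.log_nonneg (one_le_natCast q)
  have hcast : ((m ^ 2 * q : ℕ+) : ℝ) = (m : ℝ) ^ 2 * q := by simp
  rw [kern, kern, inv_weight, inv_weight, hcast, mul_left_comm,
    ← Real.mul_rpow (by linarith) (by linarith)]
  refine mul_le_mul ?_ ?_ (Real.rpow_nonneg ?_ _) (Real.rpow_nonneg hm.le _)
  · rw [Real.mul_rpow (by positivity) hq.le, ← Real.rpow_natCast, ← Real.rpow_mul hm.le]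
    refine (mul_le_of_le_one_right (Real.rpow_nonneg hm.le _)
      (Real.rpow_le_one_of_one_le_of_nonpos (one_le_natCast q) (by linarith))).trans_eq ?_
    congr 1
    push_cast
    ring
  · refine Real.rpow_le_rpow ?_ ?_ (by linarith)
    all_goals rw [Real.log_mul (by positivity) hq.ne', Real.log_pow]; push_cast
    · positivity
    · nlinarith
  · rw [Real.log_mul (by positivity) hq.ne', Real.log_pow]
    push_cast
    positivity

/-- The doubling property. A smooth `n` is `m² q` with `m` smooth and `q` among finitely many
products of distinct primes; passing from `n` to `m` doubles the exponent at the cost of a factor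
depending on `q`, and `n ↦ m` is injective for fixed `q`. -/
lemma exists_kernSum_le {α : ℝ} (hα : -1 < α) (N : ℕ) :
    ∃ C, 1 ≤ C ∧ ∀ σ, 0 < σ → kernSum α N σ ≤ C * kernSum α N (2 * σ) := by
  have hdec : ∀ n : ℕ+, ∃ p : ℕ+ × ℕ+, n ∈ smoothSet N → n = p.1 ^ 2 * p.2 ∧ p.1 ∈ smoothSet N ∧
      (p.2 : ℕ) ∈ (N.primesBelow.powerset.image fun s => s.prod id) := by
    intro n
    by_cases hn : n ∈ smoothSet N
    · obtain ⟨s, hs, m, hm⟩ := Nat.eq_prod_primes_mul_sq_of_mem_smoothNumbers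
        (show (n : ℕ) ∈ N.smoothNumbers from hn)
      have hm0 : 0 < m := Nat.pos_of_ne_zero fun h => n.ne_zero (by rw [hm, h]; simp)
      have hs0 : 0 < s.prod id := Nat.pos_of_ne_zero fun h => n.ne_zero (by rw [hm, h]; simp)
      refine ⟨(⟨m, hm0⟩, ⟨s.prod id, hs0⟩), fun _ => ⟨PNat.coe_injective hm, ?_,
        Finset.mem_image_of_mem _ hs⟩⟩
      exact Nat.mem_smoothNumbers_of_dvd hn (k := m) (by rw [hm, sq, mul_assoc]; exact dvd_mul_right _ _)
    · exact ⟨(1, 1), fun h => absurd h hn⟩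
  choose p hp using hdec
  set Q := N.primesBelow.powerset.image fun s => s.prod id with hQ
  set C : ℝ := ∑ q ∈ Q, (2 + Real.log (q : ℝ)) ^ (α + 1) with hC
  have hCnn : 0 ≤ C := Finset.sum_nonneg fun q _ => Real.rpow_nonneg
    (by have := Real.log_natCast_nonneg q; linarith) _
  refine ⟨1 + C, by linarith, fun σ hσ => ?_⟩
  have hS2 := summable_kern_smoothSet hα N (mul_pos two_pos hσ)
  have hle : kernSum α N σ ≤ C * kernSum α N (2 * σ) := by
    refine (summable_kern_smoothSet hα N hσ).tsum_le_of_sum_le fun A => ?_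
    classical
    rw [← Finset.sum_filter_of_ne (p := fun n => n ∈ smoothSet N)
      (fun n _ h => Set.mem_of_indicator_ne_zero h)]
    set B := A.filter fun n => n ∈ smoothSet N
    have hB : ∀ n ∈ B, n ∈ smoothSet N := fun n hn => (Finset.mem_filter.1 hn).2
    rw [← Finset.sum_fiberwise_of_maps_to (t := Q) (g := fun n => ((p n).2 : ℕ))
      (fun n hn => (hp n (hB n hn)).2.2), hC, Finset.sum_mul]
    refine Finset.sum_le_sum fun q _ => ?_
    set D := B.filter fun n => ((p n).2 : ℕ) = q
    have hD : ∀ n ∈ D, n ∈ smoothSet N ∧ ((p n).2 : ℕ) = q := fun n hn =>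
      ⟨hB n (Finset.mem_filter.1 hn).1, (Finset.mem_filter.1 hn).2⟩
    have hinj : Set.InjOn (fun n => (p n).1) D := by
      intro n hn n' hn' h
      obtain ⟨h1, h2⟩ := hD n hn
      obtain ⟨h3, h4⟩ := hD n' hn'
      have h5 : (p n).2 = (p n').2 := PNat.coe_injective (h2.trans h4.symm)
      have h6 : (p n).1 = (p n').1 := h
      rw [(hp n h1).1, (hp n' h3).1, h5, h6]
    calc ∑ n ∈ D, (smoothSet N).indicator (kern α σ) n
        ≤ ∑ n ∈ D, (2 + Real.log (q : ℝ)) ^ (α + 1) *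
            (smoothSet N).indicator (kern α (2 * σ)) (p n).1 := by
          refine Finset.sum_le_sum fun n hn => ?_
          obtain ⟨h1, h2⟩ := hD n hn
          rw [Set.indicator_of_mem h1, Set.indicator_of_mem (hp n h1).2.1, ← h2]
          conv_lhs => rw [(hp n h1).1]
          exact kern_sq_mul_le hα hσ _ _
      _ = (2 + Real.log (q : ℝ)) ^ (α + 1) *
            ∑ m ∈ D.image fun n => (p n).1, (smoothSet N).indicator (kern α (2 * σ)) m := by
          rw [Finset.sum_image hinj, Finset.mul_sum]
      _ ≤ _ := mul_le_mul_of_nonneg_left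
          (hS2.sum_le_tsum _ fun m _ => kern_indicator_nonneg _ _ _ m)
          (Real.rpow_nonneg (by have := Real.log_natCast_nonneg q; linarith) _)
  have := kernSum_nonneg α N (2 * σ)
  linarith

/-- The powers of `2` suffice: the first `J` of them contribute at least a sum tending to `J`. -/
lemma tendsto_kernSum_atTop {α : ℝ} (hα : -1 < α) {N : ℕ} (hN : 3 ≤ N) :
    Tendsto (kernSum α N) (𝓝[>] 0) atTop := by
  refine tendsto_atTop.2 fun B => ?_
  obtain ⟨J, hJ⟩ := exists_nat_gt B
  have hcont : Tendsto (fun σ : ℝ => ∑ j ∈ Finset.range J, (2 ^ j : ℝ) ^ (-2 * σ)) (𝓝[>] 0)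
      (𝓝 J) := by
    have hc : Continuous (fun σ : ℝ => ∑ j ∈ Finset.range J, (2 ^ j : ℝ) ^ (-2 * σ)) :=
      continuous_finsetSum _ fun j _ => Continuous.rpow continuous_const (by fun_prop)
        fun _ => Or.inl (by positivity)
    have := (hc.tendsto 0).mono_left (nhdsWithin_le_nhds (s := Set.Ioi 0))
    simpa using this
  filter_upwards [hcont.eventually (lt_mem_nhds hJ), self_mem_nhdsWithin] with σ h hσ
  refine h.le.trans ?_
  have hinj : Function.Injective fun j : ℕ => (2 : ℕ+) ^ j := fun i j hij => by
    have : ((2 : ℕ+) ^ i : ℕ+).val = ((2 : ℕ+) ^ j : ℕ+).val := congrArg _ hij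
    simp only [PNat.pow_coe] at this
    exact Nat.pow_right_injective le_rfl this
  refine le_trans ?_ ((summable_kern_smoothSet hα N hσ).sum_le_tsum
    ((Finset.range J).map ⟨_, hinj⟩) fun m _ => kern_indicator_nonneg _ _ _ m)
  rw [Finset.sum_map]
  refine Finset.sum_le_sum fun j _ => ?_
  have hmem : (2 : ℕ+) ^ j ∈ smoothSet N := Nat.mem_smoothNumbers'.2 fun p hp hpn => by
    rw [PNat.pow_coe] at hpn
    have := Nat.le_of_dvd (by norm_num) (hp.dvd_of_dvd_pow hpn)
    simp at this
    omega
  simp only [Function.Embedding.coeFn_mk]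
  rw [Set.indicator_of_mem hmem, kern, inv_weight]
  have : (((2 : ℕ+) ^ j : ℕ+) : ℝ) = 2 ^ j := by simp
  rw [this]
  refine le_mul_of_one_le_right (by positivity) (Real.one_le_rpow ?_ (by linarith))
  have := Real.log_nonneg (one_le_pow₀ (M₀ := ℝ) one_le_two (n := j))
  linarith

namespace IsSmoothSymbol

variable {α : ℝ} {c₀ N : ℕ} {Φ Ψ : ℂ → ℂ} {T : Space α →L[ℂ] Space α}

lemma coeff_map_poly (h : IsSmoothSymbol α c₀ N Φ T) {F : Finset ℕ+}
    (hF : ∀ n ∈ F, n ∈ smoothSet N) (a : ℕ+ → ℂ) (m : ℕ+) (hm : (T (poly α F a)).coeff m ≠ 0) :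
    m ∈ smoothSet N := by
  rw [poly, map_sum, coeff_sum] at hm
  obtain ⟨n, hn, hne⟩ := Finset.exists_ne_zero_of_sum_ne_zero hm
  rw [map_smul, coeff_smul] at hne
  exact (h.coeff_support n (hF n hn) m (right_ne_zero_of_mul hne)).1

lemma eval_map_poly (h : IsSmoothSymbol α c₀ N Φ T)
    (hΨ : DifferentiableOn ℂ Ψ (halfPlane 0)) (hΨΦ : Set.EqOn Ψ Φ (halfPlane (1 / 2)))
    {F : Finset ℕ+} (hF : ∀ n ∈ F, n ∈ smoothSet N) (a : ℕ+ → ℂ) {s : ℂ} (hs : 0 < s.re) :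
    (T (poly α F a)).eval s = ∑ n ∈ F, a n * (n : ℂ) ^ (-Ψ s) := by
  rw [poly, map_sum]
  simp_rw [map_smul]
  rw [eval_sum _ _ _ fun n hn => h.summable (hF n hn) hs]
  exact Finset.sum_congr rfl fun n hn => by rw [h.eval_map_monomial hΨ hΨΦ (hF n hn) hs]

/-- The finite head of `T f` is bounded uniformly in `s`, since `|m^{-s}| ≤ 1`; its tail costs `ε
√K(Re s)`. The test functions are finite sections of the reproducing kernel at `Ψ(s)`, so that only
Dirichlet polynomials have to be composed with `Ψ`. -/
lemma exists_sqrt_kernSum_le (h : IsSmoothSymbol α c₀ N Φ T)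
    (hΨ : DifferentiableOn ℂ Ψ (halfPlane 0)) (hΨΦ : Set.EqOn Ψ Φ (halfPlane (1 / 2)))
    (hmaps : ∀ s : ℂ, 0 < s.re → 0 < (Ψ s).re) (hT : IsCompactOperator T) {ε : ℝ} (hε : 0 < ε) :
    ∃ C, ∀ s : ℂ, 0 < s.re →
      √(kernSum α N (Ψ s).re) ≤ C + ε * √(kernSum α N s.re) := by
  obtain ⟨F, hF⟩ := exists_finset_tail_le hT hε
  set C := ∑ m ∈ F, ‖T‖ * √(weight α m)⁻¹ with hC
  have hC0 : 0 ≤ C := Finset.sum_nonneg fun m _ => mul_nonneg (norm_nonneg T) (Real.sqrt_nonneg _)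
  have hbound : ∀ (f : Space α), (∀ m, (T f).coeff m ≠ 0 → m ∈ smoothSet N) → ∀ s : ℂ, 0 < s.re →
      ‖(T f).eval s‖ ≤ ‖f‖ * (C + ε * √(kernSum α N s.re)) := by
    intro f hf s hs
    have hS := summable_kern_smoothSet h.neg_one_lt N hs
    set g := T f
    have hr : ∀ m, (g - poly α F g.coeff).coeff m ≠ 0 → m ∈ smoothSet N := fun m hm => hf m
      fun h0 => hm (by rw [coeff_sub, coeff_poly, h0]; simp)
    have h1 := (summable_norm_and_norm_eval_le hr hS).2
    have h2 : (poly α F g.coeff).eval s = ∑ m ∈ F, g.coeff m * (m : ℂ) ^ (-s) := by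
      rw [eval, tsum_eq_sum (s := F) fun n hn => by simp [coeff_poly, hn]]
      exact Finset.sum_congr rfl fun n hn => by rw [coeff_poly, if_pos hn]
    have h3 : g.eval s = (poly α F g.coeff).eval s + (g - poly α F g.coeff).eval s := by
      have hs1 := (summable_norm_and_norm_eval_le hf hS).1.of_norm
      have hs2 := (summable_norm_and_norm_eval_le hr hS).1.of_norm
      have hs3 : Summable fun m => (poly α F g.coeff).coeff m * (m : ℂ) ^ (-s) :=
        summable_of_ne_finset_zero (s := F) fun n hn => by simp [coeff_poly, hn]
      rw [eval, eval, eval, ← hs3.tsum_add hs2]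
      exact tsum_congr fun m => by rw [coeff_sub]; ring
    have h4 : ‖(poly α F g.coeff).eval s‖ ≤ ‖f‖ * C := by
      rw [h2, hC, Finset.mul_sum]
      refine norm_sum_le_of_le F fun m _ => ?_
      rw [norm_mul_cpow]
      have hw := weight_pos α m
      have e1 : ‖g.coeff m‖ ≤ ‖g‖ * √(weight α m)⁻¹ := by
        rw [Real.sqrt_inv, ← div_eq_mul_inv, le_div_iff₀ (Real.sqrt_pos.2 hw)]
        refine abs_le_of_sq_le_sq' ?_ (norm_nonneg g) |>.2
        rw [mul_pow, Real.sq_sqrt hw.le]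
        exact norm_coeff_sq_le g m
      calc ‖g.coeff m‖ * (m : ℝ) ^ (-s.re) ≤ ‖g.coeff m‖ :=
            mul_le_of_le_one_right (norm_nonneg _)
              (Real.rpow_le_one_of_one_le_of_nonpos (one_le_natCast m) (by linarith))
        _ ≤ (‖T‖ * ‖f‖) * √(weight α m)⁻¹ :=
            e1.trans (mul_le_mul_of_nonneg_right (T.le_opNorm f) (Real.sqrt_nonneg _))
        _ = _ := by ring
    calc ‖g.eval s‖ ≤ ‖f‖ * C + ε * ‖f‖ * √(kernSum α N s.re) := by
          rw [h3]
          exact (norm_add_le _ _).trans (add_le_add h4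
            (h1.trans (mul_le_mul_of_nonneg_right (hF f) (Real.sqrt_nonneg _))))
      _ = _ := by ring
  refine ⟨C, fun s hs => ?_⟩
  set R := C + ε * √(kernSum α N s.re) with hR
  have hR0 : 0 ≤ R := add_nonneg hC0 (mul_nonneg hε.le (Real.sqrt_nonneg _))
  refine Real.sqrt_le_iff.2 ⟨hR0, ?_⟩
  refine (summable_kern_smoothSet h.neg_one_lt N (hmaps s hs)).tsum_le_of_sum_le fun A => ?_
  classical
  rw [← Finset.sum_filter_of_ne (p := fun n => n ∈ smoothSet N)
    (fun n _ h => Set.mem_of_indicator_ne_zero h)]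
  set B := A.filter fun n => n ∈ smoothSet N
  have hB : ∀ n ∈ B, n ∈ smoothSet N := fun n hn => (Finset.mem_filter.1 hn).2
  rw [Finset.sum_congr rfl fun n hn => Set.indicator_of_mem (hB n hn) _]
  set k := ∑ n ∈ B, kern α (Ψ s).re n with hk
  have hk0 : 0 ≤ k := Finset.sum_nonneg fun n _ => kern_nonneg _ _ n
  -- For this section both the squared norm and the value of its image at `s` equal `k`, so the
  -- bound reads `k ≤ √k · R`, whence `k ≤ R²`.
  set b : ℕ+ → ℂ := fun n => (starRingEnd ℂ) ((n : ℂ) ^ (-Ψ s)) * (((weight α n)⁻¹ : ℝ) : ℂ) with hb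
  have hsq : ∀ n : ℕ+, ‖(n : ℂ) ^ (-Ψ s)‖ ^ 2 = (n : ℝ) ^ (-2 * (Ψ s).re) := fun n => by
    have := norm_mul_cpow 1 n (Ψ s)
    rw [one_mul, norm_one, one_mul] at this
    rw [this, ← Real.rpow_natCast, ← Real.rpow_mul (natCast_pos n).le]
    congr 1
    push_cast
    ring
  have hnorm : ‖poly α B b‖ ^ 2 = k := by
    rw [norm_sq_poly, hk]
    refine Finset.sum_congr rfl fun n _ => ?_
    have hw := weight_pos α n
    rw [hb, norm_mul, mul_pow, RCLike.norm_conj, hsq, Complex.norm_real, Real.norm_of_nonneg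
      (inv_nonneg.2 hw.le), kern]
    field_simp
  have heval : (T (poly α B b)).eval s = (k : ℂ) := by
    rw [h.eval_map_poly hΨ hΨΦ hB b hs, hk, Complex.ofReal_sum]
    refine Finset.sum_congr rfl fun n _ => ?_
    rw [hb, kern, ← hsq, mul_right_comm, mul_comm ((starRingEnd ℂ) _), Complex.mul_conj,
      Complex.normSq_eq_norm_sq]
    push_cast
    ring
  have := hbound (poly α B b) (h.coeff_map_poly hB b) s hs
  rw [heval, Complex.norm_real, Real.norm_of_nonneg hk0, ← hnorm, sq] at this
  rw [← hnorm]
  rcases (norm_nonneg (poly α B b)).eq_or_lt with h0 | h0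
  · rw [← h0]
    nlinarith
  · have := le_of_mul_le_mul_left this h0
    exact pow_le_pow_left₀ h0.le this 2

/-- If `Re s ≥ η Re Ψ(s)`, then `Re Ψ(s) ≤ 2^k Re s` with `2^k > 1/η`, and `k` doublings give `√K(Re
s) ≤ D √K(Re Ψ(s))`. The compactness estimate with `ε = 1/(2D)` then bounds `√K(Re s)` by `2DA`,
which fails for small `Re s`. -/
theorem tendsto_of_isCompactOperator (h : IsSmoothSymbol α c₀ N Φ T) (hN : 3 ≤ N)
    (hΨ : DifferentiableOn ℂ Ψ (halfPlane 0)) (hΨΦ : Set.EqOn Ψ Φ (halfPlane (1 / 2)))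
    (hmaps : ∀ s : ℂ, 0 < s.re → 0 < (Ψ s).re) (hT : IsCompactOperator T) :
    Tendsto (fun s : ℂ => s.re / (Ψ s).re) reToZero (𝓝 0) := by
  obtain ⟨C, hC1, hC⟩ := exists_kernSum_le h.neg_one_lt N
  rw [Metric.tendsto_nhds]
  intro η hη
  obtain ⟨k, hk⟩ := pow_unbounded_of_one_lt (1 / η) one_lt_two
  have hpow : ∀ j : ℕ, ∀ σ, 0 < σ → kernSum α N σ ≤ C ^ j * kernSum α N (2 ^ j * σ) := by
    intro j
    induction j with
    | zero => intro σ _; simp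
    | succ j ih =>
      intro σ hσ
      calc _ ≤ C ^ j * kernSum α N (2 ^ j * σ) := ih σ hσ
        _ ≤ C ^ j * (C * kernSum α N (2 * (2 ^ j * σ))) :=
            mul_le_mul_of_nonneg_left (hC _ (by positivity)) (by positivity)
        _ = _ := by
            rw [pow_succ, pow_succ, mul_assoc]
            congr 3
            ring
  set D := √(C ^ k) with hD
  have hD0 : 0 < D := Real.sqrt_pos.2 (by positivity)
  obtain ⟨A, hA⟩ := h.exists_sqrt_kernSum_le hΨ hΨΦ hmaps hT (ε := 1 / (2 * D)) (by positivity)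
  have hbig : ∀ᶠ σ in 𝓝[>] (0 : ℝ), 2 * D * A < √(kernSum α N σ) :=
    (Real.tendsto_sqrt_atTop.comp (tendsto_kernSum_atTop h.neg_one_lt hN)).eventually_gt_atTop _
  have hpos : ∀ᶠ σ in 𝓝[>] (0 : ℝ), 0 < σ := self_mem_nhdsWithin
  filter_upwards [(hbig.and hpos).comap Complex.re] with s ⟨hs, hs0⟩
  have hP := hmaps s hs0
  rw [Real.dist_eq, sub_zero, abs_of_pos (div_pos hs0 hP), div_lt_iff₀ hP]
  by_contra! hle
  have h1 : (Ψ s).re ≤ 2 ^ k * s.re := by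
    have : (Ψ s).re ≤ 1 / η * s.re := by
      rw [one_div, ← div_eq_inv_mul, le_div_iff₀ hη]
      linarith
    exact this.trans (mul_le_mul_of_nonneg_right hk.le hs0.le)
  have h2 : √(kernSum α N s.re) ≤ D * √(kernSum α N (Ψ s).re) := by
    rw [hD, ← Real.sqrt_mul (by positivity)]
    refine Real.sqrt_le_sqrt ((hpow k _ hs0).trans ?_)
    exact mul_le_mul_of_nonneg_left (kernSum_anti h.neg_one_lt N hP h1) (by positivity)
  have h3 := mul_le_mul_of_nonneg_left (hA s hs0) hD0.le
  have h4 : D * (A + 1 / (2 * D) * √(kernSum α N s.re)) = D * A + √(kernSum α N s.re) / 2 := by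
    field_simp
  linarith

end IsSmoothSymbol

/-! ### Harmonic extension and subordination on vertical lines -/

/-- The integral over a vertical segment of an analytic function that decays exponentially to the
right is bounded, whatever the length of the segment. -/
lemma norm_integral_vertical_le {G : ℂ → ℂ} (hG : DifferentiableOn ℂ G (halfPlane 0)) {a : ℝ}
    (ha : 0 < a) (hb : ∀ s : ℂ, 0 < s.re → ‖G s‖ ≤ Real.exp (-a * s.re)) {σ : ℝ} (hσ : 0 < σ)
    {R : ℝ} (hR : 0 ≤ R) : ‖∫ y in -R..R, G (σ + y * Complex.I)‖ ≤ 2 / a := by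
  have hhor : ∀ (X y : ℝ), σ < X → ‖∫ x in σ..X, G (x + y * Complex.I)‖ ≤ 1 / a := by
    intro X y hX
    have hcont : Continuous fun x : ℝ => Real.exp (-a * x) := by fun_prop
    refine (intervalIntegral.norm_integral_le_of_norm_le hX.le
      (g := fun x => Real.exp (-a * x)) ?_ (hcont.intervalIntegrable _ _)).trans ?_
    · refine MeasureTheory.ae_of_all _ fun x hx => ?_
      have := hb (x + y * Complex.I) (by simpa using hσ.trans hx.1)
      simpa using this
    · have hder : ∀ x ∈ Set.uIcc σ X, HasDerivAt (fun x : ℝ => -(Real.exp (-a * x) / a))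
          (Real.exp (-a * x)) x := by
        intro x _
        have : HasDerivAt (fun x : ℝ => -(Real.exp (-a * x) / a))
            (-(Real.exp (-a * x) * (-a * 1) / a)) x :=
          ((((hasDerivAt_id x).const_mul (-a)).exp).div_const a).neg
        refine this.congr_deriv ?_
        field_simp
      rw [intervalIntegral.integral_eq_sub_of_hasDerivAt hder (hcont.intervalIntegrable _ _)]
      have h1 : Real.exp (-a * σ) ≤ 1 := Real.exp_le_one_iff.2 (by nlinarith)
      have h2 := Real.exp_pos (-a * X)
      rw [neg_sub_neg, ← sub_div]
      exact div_le_div_of_nonneg_right (by linarith) ha.le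
  have key : ∀ X, σ < X → ‖∫ y in -R..R, G (σ + y * Complex.I)‖ ≤
      2 / a + Real.exp (-a * X) * (2 * R) := by
    intro X hX
    -- Cauchy's theorem on `[σ, X] × [-R, R]`: each horizontal side costs at most `1/a`, and the
    -- right side disappears as `X → ∞`.
    have hrect := Complex.integral_boundary_rect_eq_zero_of_differentiableOn G
      ⟨σ, -R⟩ ⟨X, R⟩ (hG.mono fun z hz => by
        have := (Complex.mem_reProdIm.1 hz).1
        rw [Set.uIcc_of_le hX.le] at this
        exact hσ.trans_le this.1)
    simp only at hrect
    have hver : ‖∫ y in -R..R, G (X + y * Complex.I)‖ ≤ Real.exp (-a * X) * (2 * R) := by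
      refine (intervalIntegral.norm_integral_le_of_norm_le_const
        (C := Real.exp (-a * X)) fun y _ => ?_).trans_eq ?_
      · simpa using hb (X + y * Complex.I) (by simpa using hσ.trans hX)
      · rw [sub_neg_eq_add, ← two_mul, abs_of_nonneg (by linarith)]
    have h1 := hhor X (-R) hX
    have h2 := hhor X R hX
    have h3 : Complex.I • (∫ y in -R..R, G (σ + y * Complex.I)) =
        (∫ x in σ..X, G (x + (-R : ℝ) * Complex.I)) - (∫ x in σ..X, G (x + R * Complex.I)) +
          Complex.I • ∫ y in -R..R, G (X + y * Complex.I) := by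
      linear_combination -hrect
    have h4 := congrArg norm h3
    rw [norm_smul, Complex.norm_I, one_mul] at h4
    rw [h4]
    refine (norm_add_le _ _).trans ?_
    rw [norm_smul, Complex.norm_I, one_mul]
    have h5 := norm_sub_le (∫ x in σ..X, G (x + (-R : ℝ) * Complex.I))
      (∫ x in σ..X, G (x + R * Complex.I))
    have h6 : 2 / a = 1 / a + 1 / a := by ring
    linarith
  have ht : Tendsto (fun X : ℝ => 2 / a + Real.exp (-a * X) * (2 * R)) atTop
      (𝓝 (2 / a + 0 * (2 * R))) := by
    refine ((Real.tendsto_exp_atBot.comp ?_).mul_const _).const_add _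
    exact tendsto_id.const_mul_atTop_of_neg (by linarith)
  rw [zero_mul, add_zero] at ht
  exact ge_of_tendsto ht (by filter_upwards [eventually_gt_atTop σ] with X hX using key X hX)

/-- The kernel of the harmonic extension to `{Re w > η}` of `n ^ (-w) * conj (m ^ (-w))`. -/
def harmKern (η : ℝ) (n m : ℕ+) (w : ℂ) : ℂ :=
  (n : ℂ) ^ (-w) * (starRingEnd ℂ) ((m : ℂ) ^ (-w)) *
    (((min n m : ℕ+) : ℝ) ^ (2 * (w.re - η)) : ℝ)

lemma natCast_cpow_eq (n : ℕ+) (w : ℂ) : (n : ℂ) ^ (-w) = Complex.exp (-w * Real.log n) := by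
  rw [Complex.cpow_def_of_ne_zero (by exact_mod_cast n.ne_zero), Complex.ofReal_log
    (natCast_pos n).le, mul_comm]
  simp

lemma harmKern_symm (η : ℝ) (n m : ℕ+) (w : ℂ) :
    harmKern η n m w = (starRingEnd ℂ) (harmKern η m n w) := by
  simp only [harmKern, map_mul, Complex.conj_conj, Complex.conj_ofReal, min_comm m n]
  ring

/-- The reason for the power of `min n m`: `conj (m^{-w}) m^{2 Re w} = m^w`, so the kernel is a
constant times the analytic function `(n/m)^{-w}`, and contour integration applies after composing
with `Ψ`. -/
lemma harmKern_of_le (η : ℝ) {n m : ℕ+} (h : m ≤ n) (w : ℂ) :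
    harmKern η n m w = ((m : ℝ) ^ (-2 * η) : ℝ) *
      Complex.exp (-w * (Real.log n - Real.log m : ℝ)) := by
  rw [harmKern, min_eq_right h, natCast_cpow_eq, natCast_cpow_eq, ← Complex.exp_conj,
    Real.rpow_def_of_pos (natCast_pos m), Real.rpow_def_of_pos (natCast_pos m),
    Complex.ofReal_exp, Complex.ofReal_exp, ← Complex.exp_add, ← Complex.exp_add, ← Complex.exp_add]
  congr 1
  have := Complex.add_conj w
  simp only [Complex.ofReal_sub, Complex.ofReal_mul, Complex.ofReal_neg, Complex.ofReal_ofNat,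
    map_mul, map_neg, Complex.conj_ofReal] at this ⊢
  linear_combination (-(Real.log (m : ℝ)) : ℂ) * this

lemma harmKern_self (η : ℝ) (n : ℕ+) (w : ℂ) :
    harmKern η n n w = ((n : ℝ) ^ (-2 * η) : ℝ) := by
  rw [harmKern_of_le η le_rfl, sub_self]
  simp

/-- The quadratic form of `harmKern`: the harmonic extension of the squared modulus of the Dirichlet
polynomial `∑ a_n n ^ (-w)` on the line `Re w = η`. -/
def harmExt (F : Finset ℕ+) (a : ℕ+ → ℂ) (η : ℝ) (w : ℂ) : ℂ :=
  ∑ n ∈ F, ∑ m ∈ F, a n * (starRingEnd ℂ) (a m) * harmKern η n m w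

lemma sum_mul_conj_sum (F : Finset ℕ+) (b : ℕ+ → ℂ) :
    ∑ n ∈ F, ∑ m ∈ F, b n * (starRingEnd ℂ) (b m) = ((‖∑ n ∈ F, b n‖ ^ 2 : ℝ) : ℂ) := by
  rw [← Complex.normSq_eq_norm_sq, ← Complex.mul_conj, map_sum, Finset.sum_mul_sum]

/-- The kernel `min (n, m) ^ y - 1` is positive semidefinite. -/
lemma norm_sum_sq_le_sum_min (F : Finset ℕ+) (b : ℕ+ → ℂ) {y : ℝ} (hy : 0 ≤ y) :
    ‖∑ n ∈ F, b n‖ ^ 2 ≤ (∑ n ∈ F, ∑ m ∈ F, b n * (starRingEnd ℂ) (b m) *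
      (((min n m : ℕ+) : ℝ) ^ y : ℝ)).re := by
  -- Telescoping gives `min(n,m)^y = 1 + ∑ d_i χ_i(n) χ_i(m)`, a sum of rank one positive kernels
  -- because the increments `d_i` are nonnegative.
  set d : ℕ → ℝ := fun i => ((i + 1 + 1 : ℕ) : ℝ) ^ y - ((i + 1 : ℕ) : ℝ) ^ y with hd
  have hd0 : ∀ i, 0 ≤ d i := fun i => sub_nonneg.2
    (Real.rpow_le_rpow (Nat.cast_nonneg _) (by push_cast; linarith) hy)
  set B := F.sup fun n => (n : ℕ) with hB
  set χ : ℕ → ℕ+ → ℂ := fun i n => if i + 1 < (n : ℕ) then 1 else 0 with hχ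
  have hmin : ∀ n ∈ F, ∀ m ∈ F, ((((min n m : ℕ+) : ℝ) ^ y : ℝ) : ℂ) =
      1 + ∑ i ∈ Finset.range B, (d i : ℂ) * (χ i n * χ i m) := by
    intro n hn m _
    obtain ⟨j, hj⟩ := Nat.exists_eq_succ_of_ne_zero (min n m).ne_zero
    have hjB : j ≤ B := by
      have h1 : (n : ℕ) ≤ B := Finset.le_sup (f := fun n : ℕ+ => (n : ℕ)) hn
      have h2 : ((min n m : ℕ+) : ℕ) ≤ n := min_le_left n m
      omega
    have hprod : ∀ i, (d i : ℂ) * (χ i n * χ i m) = if i < j then (d i : ℂ) else 0 := by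
      intro i
      have h3 : i < j ↔ (i + 1 < (n : ℕ) ∧ i + 1 < (m : ℕ)) := by
        have : i + 1 < ((min n m : ℕ+) : ℕ) ↔ (i + 1 < (n : ℕ) ∧ i + 1 < (m : ℕ)) := by
          rcases le_total n m with h | h
          · rw [min_eq_left h]
            have : (n : ℕ) ≤ m := h
            omega
          · rw [min_eq_right h]
            have : (m : ℕ) ≤ n := h
            omega
        omega
      simp only [hχ, h3]
      by_cases h4 : i + 1 < (n : ℕ) <;> by_cases h5 : i + 1 < (m : ℕ) <;> simp [h4, h5]
    rw [Finset.sum_congr rfl fun i _ => hprod i, ← Finset.sum_filter]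
    have hfil : (Finset.range B).filter (fun i => i < j) = Finset.range j := by
      ext i
      simp only [Finset.mem_filter, Finset.mem_range]
      omega
    rw [hfil, ← Complex.ofReal_sum, hd,
      Finset.sum_range_sub (fun i : ℕ => ((i + 1 : ℕ) : ℝ) ^ y) j, hj]
    simp
  have hexp : ∑ n ∈ F, ∑ m ∈ F, b n * (starRingEnd ℂ) (b m) *
      (((min n m : ℕ+) : ℝ) ^ y : ℝ) = ((‖∑ n ∈ F, b n‖ ^ 2 +
        ∑ i ∈ Finset.range B, d i * ‖∑ n ∈ F, χ i n * b n‖ ^ 2 : ℝ) : ℂ) := by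
    have h1 : ∀ n ∈ F, ∀ m ∈ F, b n * (starRingEnd ℂ) (b m) *
        (((min n m : ℕ+) : ℝ) ^ y : ℝ) = b n * (starRingEnd ℂ) (b m) +
          ∑ i ∈ Finset.range B, (d i : ℂ) * (χ i n * b n * (starRingEnd ℂ) (χ i m * b m)) := by
      intro n hn m hm
      rw [hmin n hn m hm, mul_add, mul_one, Finset.mul_sum]
      congr 1
      refine Finset.sum_congr rfl fun i _ => ?_
      have : (starRingEnd ℂ) (χ i m) = χ i m := by simp only [hχ]; split_ifs <;> simp
      rw [map_mul, this]
      ring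
    rw [Finset.sum_congr rfl fun n hn => Finset.sum_congr rfl fun m hm => h1 n hn m hm]
    simp_rw [Finset.sum_add_distrib]
    rw [sum_mul_conj_sum, Complex.ofReal_add, Complex.ofReal_sum]
    congr 1
    simp_rw [Finset.sum_comm (s := F) (t := Finset.range B)]
    refine Finset.sum_congr rfl fun i _ => ?_
    rw [Complex.ofReal_mul, ← sum_mul_conj_sum F (fun n => χ i n * b n)]
    simp_rw [← Finset.mul_sum]
  rw [hexp, Complex.ofReal_re]
  have : 0 ≤ ∑ i ∈ Finset.range B, d i * ‖∑ n ∈ F, χ i n * b n‖ ^ 2 :=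
    Finset.sum_nonneg fun i _ => mul_nonneg (hd0 i) (sq_nonneg _)
  linarith

lemma harmExt_eq (F : Finset ℕ+) (a : ℕ+ → ℂ) (η : ℝ) (w : ℂ) :
    harmExt F a η w = ∑ n ∈ F, ∑ m ∈ F, a n * (n : ℂ) ^ (-w) *
      (starRingEnd ℂ) (a m * (m : ℂ) ^ (-w)) * (((min n m : ℕ+) : ℝ) ^ (2 * (w.re - η)) : ℝ) := by
  refine Finset.sum_congr rfl fun n _ => Finset.sum_congr rfl fun m _ => ?_
  rw [harmKern, map_mul]
  ring

lemma norm_sum_sq_le_harmExt (F : Finset ℕ+) (a : ℕ+ → ℂ) {η : ℝ} {w : ℂ} (h : η ≤ w.re) :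
    ‖∑ n ∈ F, a n * (n : ℂ) ^ (-w)‖ ^ 2 ≤ (harmExt F a η w).re := by
  rw [harmExt_eq]
  exact norm_sum_sq_le_sum_min F (fun n => a n * (n : ℂ) ^ (-w)) (by linarith)

lemma harmExt_of_re_eq (F : Finset ℕ+) (a : ℕ+ → ℂ) {η : ℝ} {w : ℂ} (h : w.re = η) :
    (harmExt F a η w).re = ‖∑ n ∈ F, a n * (n : ℂ) ^ (-w)‖ ^ 2 := by
  rw [harmExt_eq, h, sub_self, mul_zero]
  simp only [Real.rpow_zero, Complex.ofReal_one, mul_one]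
  rw [sum_mul_conj_sum F (fun n => a n * (n : ℂ) ^ (-w)), Complex.ofReal_re]

lemma continuous_vertical {Ψ : ℂ → ℂ} (hΨ : DifferentiableOn ℂ Ψ (halfPlane 0))
    {σ : ℝ} (hσ : 0 < σ) : Continuous fun t : ℝ => Ψ (σ + t * Complex.I) :=
  hΨ.continuousOn.comp_continuous (by fun_prop) fun t => by simpa [halfPlane] using hσ

lemma continuous_harmKern {Ψ : ℂ → ℂ} (hΨ : DifferentiableOn ℂ Ψ (halfPlane 0))
    {σ : ℝ} (hσ : 0 < σ) (η : ℝ) (n m : ℕ+) :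
    Continuous fun t : ℝ => harmKern η n m (Ψ (σ + t * Complex.I)) := by
  have hc := continuous_vertical hΨ hσ
  have h1 : ∀ k : ℕ+, Continuous fun t : ℝ => (k : ℂ) ^ (-Ψ (σ + t * Complex.I)) := fun k =>
    hc.neg.const_cpow (Or.inl (by exact_mod_cast k.ne_zero))
  refine ((h1 n).mul (Complex.continuous_conj.comp (h1 m))).mul
    (Complex.continuous_ofReal.comp (Continuous.rpow continuous_const ?_ fun _ =>
      Or.inl (natCast_pos _).ne'))
  exact continuous_const.mul ((Complex.continuous_re.comp hc).sub continuous_const)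

lemma continuous_harmExt {Ψ : ℂ → ℂ} (hΨ : DifferentiableOn ℂ Ψ (halfPlane 0))
    {σ : ℝ} (hσ : 0 < σ) (F : Finset ℕ+) (a : ℕ+ → ℂ) (η : ℝ) :
    Continuous fun t : ℝ => harmExt F a η (Ψ (σ + t * Complex.I)) :=
  continuous_finsetSum _ fun n _ => continuous_finsetSum _ fun m _ =>
    continuous_const.mul (continuous_harmKern hΨ hσ η n m)

/-- Off the diagonal, `Re Ψ(s) ≥ Re s` gives decay at rate `|log n - log m|`, so those integrals
stay bounded as `R` grows, while the diagonal kernel is constant. -/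
lemma exists_norm_integral_harmKern_le {Ψ : ℂ → ℂ} (hΨ : DifferentiableOn ℂ Ψ (halfPlane 0))
    (hre : ∀ s : ℂ, 0 < s.re → s.re ≤ (Ψ s).re) {σ : ℝ} (hσ : 0 < σ) (η : ℝ) (n m : ℕ+) : ∃ K, ∀ R : ℝ, 0 ≤ R →
    ‖(∫ t in -R..R, harmKern η n m (Ψ (σ + t * Complex.I))) -
      (if n = m then ((2 * R * (n : ℝ) ^ (-2 * η) : ℝ) : ℂ) else 0)‖ ≤ K := by
  have hlt : ∀ n m : ℕ+, m < n → ∃ K, ∀ R : ℝ, 0 ≤ R →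
      ‖∫ t in -R..R, harmKern η n m (Ψ (σ + t * Complex.I))‖ ≤ K := by
    intro n m hmn
    set L := Real.log n - Real.log m with hL
    have hL0 : 0 < L := sub_pos.2 (Real.log_lt_log (natCast_pos m) (by exact_mod_cast hmn))
    refine ⟨(m : ℝ) ^ (-2 * η) * (2 / L), fun R hR => ?_⟩
    simp_rw [harmKern_of_le η hmn.le]
    rw [intervalIntegral.integral_const_mul, norm_mul, Complex.norm_real, Real.norm_of_nonneg
      (Real.rpow_nonneg (natCast_pos m).le _)]
    refine mul_le_mul_of_nonneg_left (norm_integral_vertical_le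
      (G := fun s => Complex.exp (-Ψ s * (L : ℂ))) ((hΨ.neg.mul_const _).cexp) hL0
      (fun s hs => ?_) hσ hR) (Real.rpow_nonneg (natCast_pos m).le _)
    rw [Complex.norm_exp]
    refine Real.exp_le_exp.2 ?_
    have := hre s hs
    simp
    nlinarith
  rcases lt_trichotomy n m with h | h | h
  · obtain ⟨K, hK⟩ := hlt m n h
    refine ⟨K, fun R hR => ?_⟩
    rw [if_neg h.ne, sub_zero]
    simp_rw [harmKern_symm η n m]
    have : (∫ t in -R..R, (starRingEnd ℂ) (harmKern η m n (Ψ (σ + t * Complex.I)))) =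
        (starRingEnd ℂ) (∫ t in -R..R, harmKern η m n (Ψ (σ + t * Complex.I))) := by
      simp only [intervalIntegral, map_sub, integral_conj]
    rw [this, RCLike.norm_conj]
    exact hK R hR
  · refine ⟨0, fun R _ => ?_⟩
    subst h
    simp_rw [harmKern_self, intervalIntegral.integral_const, if_true]
    refine le_of_eq (norm_eq_zero.2 ?_)
    rw [Complex.real_smul]
    push_cast
    ring
  · obtain ⟨K, hK⟩ := hlt n m h
    refine ⟨K, fun R hR => ?_⟩
    rw [if_neg h.ne', sub_zero]
    exact hK R hR

/-- The mean of the harmonic extension along the image of a vertical line does not depend on `Ψ`.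
For `Ψ = id` and `η = σ` it is the mean square of the polynomial on that line (Carlson's formula).
-/
lemma exists_abs_integral_harmExt_le {Ψ : ℂ → ℂ} (hΨ : DifferentiableOn ℂ Ψ (halfPlane 0))
    (hre : ∀ s : ℂ, 0 < s.re → s.re ≤ (Ψ s).re) {σ : ℝ} (hσ : 0 < σ) (F : Finset ℕ+) (a : ℕ+ → ℂ) (η : ℝ) : ∃ K, ∀ R : ℝ, 0 ≤ R →
    |(∫ t in -R..R, (harmExt F a η (Ψ (σ + t * Complex.I))).re) -
      2 * R * ∑ n ∈ F, ‖a n‖ ^ 2 * (n : ℝ) ^ (-2 * η)| ≤ K := by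
  choose K hK using exists_norm_integral_harmKern_le hΨ hre hσ η
  refine ⟨∑ n ∈ F, ∑ m ∈ F, ‖a n * (starRingEnd ℂ) (a m)‖ * K n m, fun R hR => ?_⟩
  have hi : ∀ n m, IntervalIntegrable (fun t : ℝ => a n * (starRingEnd ℂ) (a m) *
      harmKern η n m (Ψ (σ + t * Complex.I))) MeasureTheory.volume (-R) R := fun n m =>
    (continuous_const.mul (continuous_harmKern hΨ hσ η n m)).intervalIntegrable _ _
  have h1 : (∫ t in -R..R, harmExt F a η (Ψ (σ + t * Complex.I))) =
      ∑ n ∈ F, ∑ m ∈ F, a n * (starRingEnd ℂ) (a m) *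
        ∫ t in -R..R, harmKern η n m (Ψ (σ + t * Complex.I)) := by
    simp only [harmExt]
    have hi' : ∀ n, IntervalIntegrable (fun t : ℝ => ∑ m ∈ F, a n * (starRingEnd ℂ) (a m) *
        harmKern η n m (Ψ (σ + t * Complex.I))) MeasureTheory.volume (-R) R := fun n =>
      (continuous_finsetSum F fun m _ => continuous_const.mul
        (continuous_harmKern hΨ hσ η n m)).intervalIntegrable _ _
    rw [intervalIntegral.integral_finsetSum fun n _ => hi' n]
    refine Finset.sum_congr rfl fun n _ => ?_
    rw [intervalIntegral.integral_finsetSum fun m _ => hi n m]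
    simp_rw [intervalIntegral.integral_const_mul]
  have h2 : ((2 * R * ∑ n ∈ F, ‖a n‖ ^ 2 * (n : ℝ) ^ (-2 * η) : ℝ) : ℂ) =
      ∑ n ∈ F, ∑ m ∈ F, a n * (starRingEnd ℂ) (a m) *
        (if n = m then ((2 * R * (n : ℝ) ^ (-2 * η) : ℝ) : ℂ) else 0) := by
    simp_rw [mul_ite, mul_zero]
    rw [Complex.ofReal_mul, Complex.ofReal_sum, Finset.mul_sum]
    refine Finset.sum_congr rfl fun n hn => ?_
    rw [Finset.sum_ite_eq, if_pos hn, Complex.mul_conj, Complex.normSq_eq_norm_sq]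
    push_cast
    ring
  have h3 : ((∫ t in -R..R, (harmExt F a η (Ψ (σ + t * Complex.I))).re) -
      2 * R * ∑ n ∈ F, ‖a n‖ ^ 2 * (n : ℝ) ^ (-2 * η)) =
      ((∫ t in -R..R, harmExt F a η (Ψ (σ + t * Complex.I))) -
        ((2 * R * ∑ n ∈ F, ‖a n‖ ^ 2 * (n : ℝ) ^ (-2 * η) : ℝ) : ℂ)).re := by
    rw [Complex.sub_re, Complex.ofReal_re]
    congr 1
    exact Complex.reCLM.intervalIntegral_comp_comm
      ((continuous_harmExt hΨ hσ F a η).intervalIntegrable _ _)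
  rw [h3]
  refine (Complex.abs_re_le_norm _).trans ?_
  rw [h1, h2, ← Finset.sum_sub_distrib]
  refine norm_sum_le_of_le F fun n _ => ?_
  rw [← Finset.sum_sub_distrib]
  refine norm_sum_le_of_le F fun m _ => ?_
  rw [← mul_sub, norm_mul]
  exact mul_le_mul_of_nonneg_left (hK n m R hR) (norm_nonneg _)

/-- Uniform in `t` because the moduli of the terms depend only on `σ`. -/
lemma exists_finset_norm_eval_sub_le {α : ℝ} {g : Space α} {σ : ℝ}
    (hg : Summable fun m => ‖g.coeff m * (m : ℂ) ^ (-(σ : ℂ))‖) {ε : ℝ} (hε : 0 < ε)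
    (A : Finset ℕ+) : ∃ A', A ⊆ A' ∧ ∀ t : ℝ,
      ‖g.eval (σ + t * Complex.I) - ∑ m ∈ A', g.coeff m * (m : ℂ) ^ (-(σ + t * Complex.I))‖ ≤ ε := by
  classical
  have hev := (hg.hasSum.eventually (lt_mem_nhds (sub_lt_self _ hε))).and (eventually_ge_atTop A)
  obtain ⟨A', h1, h2⟩ := hev.exists
  refine ⟨A', h2, fun t => ?_⟩
  have hn : ∀ m : ℕ+, ‖g.coeff m * (m : ℂ) ^ (-(σ + t * Complex.I))‖ =
      ‖g.coeff m * (m : ℂ) ^ (-(σ : ℂ))‖ := fun m => by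
    rw [norm_mul_cpow, norm_mul_cpow]
    simp
  have hs : Summable fun m => ‖g.coeff m * (m : ℂ) ^ (-(σ + t * Complex.I))‖ :=
    hg.congr fun m => (hn m).symm
  rw [eval, ← hs.of_norm.sum_add_tsum_subtype_compl A', add_sub_cancel_left]
  refine (norm_tsum_le_tsum_norm (hs.subtype _)).trans ?_
  have h3 := hs.sum_add_tsum_subtype_compl A'
  simp_rw [hn] at h3 ⊢
  linarith

namespace IsSmoothSymbol

variable {α : ℝ} {c₀ N : ℕ} {Φ Ψ : ℂ → ℂ} {T : Space α →L[ℂ] Space α}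

/-- Subordination on vertical lines. -/
theorem sum_coeff_map_poly_sq_le (h : IsSmoothSymbol α c₀ N Φ T)
    (hΨ : DifferentiableOn ℂ Ψ (halfPlane 0)) (hΨΦ : Set.EqOn Ψ Φ (halfPlane (1 / 2)))
    (hre : ∀ s : ℂ, 0 < s.re → s.re ≤ (Ψ s).re) {F : Finset ℕ+} (hF : ∀ n ∈ F, n ∈ smoothSet N)
    (a : ℕ+ → ℂ) {σ η : ℝ} (hσ : 0 < σ) (hη : ∀ t : ℝ, η ≤ (Ψ (σ + t * Complex.I)).re)
    (A : Finset ℕ+) :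
    ∑ m ∈ A, ‖(T (poly α F a)).coeff m‖ ^ 2 * (m : ℝ) ^ (-2 * σ) ≤
      ∑ n ∈ F, ‖a n‖ ^ 2 * (n : ℝ) ^ (-2 * η) := by
  set g := T (poly α F a) with hg
  have hsum : Summable fun m => ‖g.coeff m * (m : ℂ) ^ (-(σ : ℂ))‖ :=
    summable_of_smooth h.neg_one_lt (h.coeff_map_poly hF a) (by simpa using hσ)
  set S := ∑' m, ‖g.coeff m * (m : ℂ) ^ (-(σ : ℂ))‖ with hS
  have hS0 : 0 ≤ S := tsum_nonneg fun m => norm_nonneg _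
  refine le_of_forall_pos_le_add fun ε hε => ?_
  -- Chosen so that `2Sδ ≤ ε`; the summand `1` covers `S = 0`.
  set δ := ε / (2 * S + 1) with hδ
  have hδ0 : 0 < δ := by positivity
  obtain ⟨A', hAA', hA'⟩ := exists_finset_norm_eval_sub_le hsum hδ0 A
  set P : ℝ → ℂ := fun t => ∑ m ∈ A', g.coeff m * (m : ℂ) ^ (-(σ + t * Complex.I)) with hP
  have hre' : ∀ t : ℝ, ((σ : ℂ) + t * Complex.I).re = σ := fun t => by simp
  have hPS : ∀ t, ‖P t‖ ≤ S := fun t => by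
    refine (norm_sum_le _ _).trans ?_
    refine le_trans (le_of_eq (Finset.sum_congr rfl fun m _ => ?_))
      (hsum.sum_le_tsum A' fun m _ => norm_nonneg _)
    rw [norm_mul_cpow, norm_mul_cpow, hre']
    simp
  -- On the line the left side is `|P|²`. Up to `2Sδ` it is below `|g|²`, and `g` is the original
  -- polynomial at `Ψ`, whose squared modulus lies below its harmonic extension from `Re w = η`.
  have hpt : ∀ t : ℝ, (harmExt A' g.coeff σ (id (σ + t * Complex.I))).re ≤
      (harmExt F a η (Ψ (σ + t * Complex.I))).re + 2 * S * δ := by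
    intro t
    rw [id, harmExt_of_re_eq A' g.coeff (hre' t)]
    have h1 := norm_sum_sq_le_harmExt F a (hη t)
    rw [← h.eval_map_poly hΨ hΨΦ hF a (by rw [hre']; exact hσ)] at h1
    have h2 : ‖P t‖ ≤ ‖g.eval (σ + t * Complex.I)‖ + δ := by
      have := norm_sub_norm_le (P t) (g.eval (σ + t * Complex.I))
      rw [norm_sub_rev] at this
      linarith [hA' t]
    have h3 := hPS t
    change ‖P t‖ ^ 2 ≤ _
    have h4 : ‖P t‖ ^ 2 ≤ ‖g.eval (σ + t * Complex.I)‖ ^ 2 + 2 * S * δ := by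
      set x := ‖P t‖
      set y := ‖g.eval (σ + t * Complex.I)‖
      have hx : 0 ≤ x := norm_nonneg _
      have hy : 0 ≤ y := norm_nonneg _
      by_cases hxy : x ≤ y
      · nlinarith [mul_nonneg hS0 hδ0.le]
      · push Not at hxy
        nlinarith [mul_nonneg (sub_nonneg.2 hxy.le) hS0]
    linarith
  obtain ⟨K₁, hK₁⟩ := exists_abs_integral_harmExt_le (Ψ := id) differentiableOn_id
    (fun s _ => le_rfl) hσ A' g.coeff σ
  obtain ⟨K₂, hK₂⟩ := exists_abs_integral_harmExt_le hΨ hre hσ F a η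
  set X := ∑ m ∈ A', ‖g.coeff m‖ ^ 2 * (m : ℝ) ^ (-2 * σ) with hX
  set Y := ∑ n ∈ F, ‖a n‖ ^ 2 * (n : ℝ) ^ (-2 * η) with hY
  -- Both mean values have errors bounded independently of `R`; letting `R` grow gives `X ≤ Y +
  -- 2Sδ`.
  have hR : ∀ R : ℝ, 0 ≤ R → 2 * R * (X - Y - 2 * S * δ) ≤ K₁ + K₂ := by
    intro R hR
    have h1 := (abs_le.1 (hK₁ R hR)).1
    have h2 := (abs_le.1 (hK₂ R hR)).2
    have hc1 := Complex.continuous_re.comp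
      (continuous_harmExt (Ψ := id) differentiableOn_id hσ A' g.coeff σ)
    have hc2 := Complex.continuous_re.comp (continuous_harmExt hΨ hσ F a η)
    have h3 := intervalIntegral.integral_mono_on (by linarith : -R ≤ R)
      (hc1.intervalIntegrable _ _) ((hc2.add (continuous_const (y := 2 * S * δ))).intervalIntegrable
        (μ := MeasureTheory.volume) _ _) fun t _ => hpt t
    simp only [Pi.add_apply] at h3
    rw [intervalIntegral.integral_add (hc2.intervalIntegrable _ _)
      (continuous_const.intervalIntegrable _ _), intervalIntegral.integral_const] at h3
    simp only [Function.comp_apply, smul_eq_mul] at h3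
    nlinarith
  have hXY : X ≤ Y + 2 * S * δ := by
    by_contra! hlt
    have hpos : 0 < X - Y - 2 * S * δ := by linarith
    have h1 := hR ((|K₁ + K₂| + 1) / (X - Y - 2 * S * δ)) (by positivity)
    rw [mul_div_assoc', div_mul_cancel₀ _ hpos.ne'] at h1
    have := le_abs_self (K₁ + K₂)
    have := abs_nonneg (K₁ + K₂)
    linarith
  have hSδ : 2 * S * δ ≤ ε := by
    rw [hδ, mul_div_assoc', div_le_iff₀ (by positivity)]
    nlinarith
  have hAX : ∑ m ∈ A, ‖g.coeff m‖ ^ 2 * (m : ℝ) ^ (-2 * σ) ≤ X :=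
    Finset.sum_le_sum_of_subset_of_nonneg hAA' fun m _ _ =>
      mul_nonneg (sq_nonneg _) (Real.rpow_nonneg (natCast_pos m).le _)
  linarith

end IsSmoothSymbol

/-! ### `Re s / Re Φ(s) → 0` implies compactness -/

namespace Space

variable {α : ℝ}

lemma toL2_surjective (α : ℝ) : Function.Surjective (toL2 α) := by
  intro y
  have hy := (lp.memℓp y).summable (by norm_num : 0 < (2 : ENNReal).toReal)
  have hw : ∀ n, ((√(weight α n) : ℝ) : ℂ) ≠ 0 := fun n =>
    Complex.ofReal_ne_zero.mpr (Real.sqrt_pos.mpr (weight_pos α n)).ne'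
  have hmul : ∀ n, ((√(weight α n) : ℝ) : ℂ) * (((√(weight α n) : ℝ) : ℂ)⁻¹ * y n) = y n :=
    fun n => mul_inv_cancel_left₀ (hw n) _
  refine ⟨⟨fun n => ((√(weight α n) : ℝ) : ℂ)⁻¹ * y n, hy.congr fun n => ?_⟩, ?_⟩
  · rw [← norm_sqrt_mul_sq, hmul]
    simp
  · ext n
    exact hmul n

/-- Completeness makes the compact operators closed in operator norm. -/
instance : CompleteSpace (Space α) := by
  have hi : IsometryEquiv (Space α) (lp (fun _ : ℕ+ => ℂ) 2) :=
    { Equiv.ofBijective (toL2 α) ⟨toL2_injective α, toL2_surjective α⟩ with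
      isometry_toFun := AddMonoidHomClass.isometry_of_norm (toL2 α) fun _ => rfl }
  exact hi.completeSpace

/-- The `n`-th coefficient as a continuous linear functional. -/
def coeffL (n : ℕ+) : Space α →L[ℂ] ℂ :=
  (coeffₗ n).mkContinuous (√(weight α n))⁻¹ fun f => by
    have hw := Real.sqrt_pos.2 (weight_pos α n)
    rw [← div_eq_inv_mul, le_div_iff₀ hw]
    refine abs_le_of_sq_le_sq' ?_ (norm_nonneg f) |>.2
    rw [mul_pow, Real.sq_sqrt (weight_pos α n).le]
    exact norm_coeff_sq_le f n

/-- Truncation to the coefficients in `F`. -/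
def truncL (F : Finset ℕ+) : Space α →L[ℂ] Space α :=
  ∑ n ∈ F, (coeffL n).smulRight (monomial α n)

lemma truncL_apply (F : Finset ℕ+) (f : Space α) : truncL F f = poly α F f.coeff := by
  rw [truncL, sum_apply]
  rfl

lemma isCompactOperator_truncL (F : Finset ℕ+) :
    IsCompactOperator (truncL F : Space α →L[ℂ] Space α) := by
  classical
  induction F using Finset.induction_on with
  | empty => exact isCompactOperator_zero
  | insert n F hn ih =>
    have h1 : IsCompactOperator ((coeffL n).smulRight (monomial α n)) :=
      (isCompactOperator_of_locallyCompactSpace_dom (coeffL (α := α) n)).clm_comp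
        (ContinuousLinearMap.toSpanSingleton ℂ (monomial α n))
    rw [truncL, Finset.sum_insert hn]
    exact h1.add ih

end Space

/-- The integral is known to be nonzero, whereas a non-integrable function has integral `0` by
convention. -/
lemma integrable_rpow_mul_density {α : ℝ} (hα : -1 < α) (n : ℕ+) :
    MeasureTheory.IntegrableOn (fun σ : ℝ => (n : ℝ) ^ (-2 * σ) * density α σ) (Set.Ioi 0) := by
  by_contra h
  have := integral_eq_weight hα n
  rw [MeasureTheory.integral_undef h] at this
  exact (weight_pos α n).ne this

lemma density_nonneg {α σ : ℝ} (hα : -1 < α) (hσ : 0 ≤ σ) : 0 ≤ density α σ :=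
  mul_nonneg (mul_nonneg (div_nonneg (Real.rpow_nonneg two_pos.le _)
    (Real.Gamma_pos_of_pos (by linarith)).le) (Real.rpow_nonneg hσ _)) (Real.exp_pos _).le

namespace IsSmoothSymbol

variable {α : ℝ} {c₀ N : ℕ} {Φ Ψ : ℂ → ℂ} {T : Space α →L[ℂ] Space α}

/-- Integrate the subordination inequality against the density. For `σ ≤ δ` use `η = Mσ`: then
`n^{-2Mσ} = (n^M)^{-2σ}` integrates to `w_{n^M}`. For `σ > δ` use `η = σ` and `n^{-2σ} ≤ n^{-2δ}`.
-/
lemma norm_map_poly_sq_le (h : IsSmoothSymbol α c₀ N Φ T)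
    (hΨ : DifferentiableOn ℂ Ψ (halfPlane 0)) (hΨΦ : Set.EqOn Ψ Φ (halfPlane (1 / 2)))
    (hre : ∀ s : ℂ, 0 < s.re → s.re ≤ (Ψ s).re) {M : ℕ} {δ : ℝ}
    (hM : ∀ s : ℂ, 0 < s.re → s.re ≤ δ → M * s.re ≤ (Ψ s).re)
    {F : Finset ℕ+} (hF : ∀ n ∈ F, n ∈ smoothSet N) (a : ℕ+ → ℂ) :
    ‖T (poly α F a)‖ ^ 2 ≤ ∑ n ∈ F, ‖a n‖ ^ 2 * (weight α (n ^ M) + (n : ℝ) ^ (-2 * δ)) := by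
  have hα := h.neg_one_lt
  rw [norm_sq_eq]
  refine (summable_coeff _).tsum_le_of_sum_le fun A => ?_
  set b := (T (poly α F a)).coeff with hb
  have hpt : ∀ σ ∈ Set.Ioi (0 : ℝ), ∑ m ∈ A, ‖b m‖ ^ 2 * ((m : ℝ) ^ (-2 * σ) * density α σ) ≤
      ∑ n ∈ F, ‖a n‖ ^ 2 * (((n ^ M : ℕ+) : ℝ) ^ (-2 * σ) * density α σ +
        -- The factor `1^{-2σ}` lets `integral_eq_weight` at `n = 1` supply the total mass `1`.
        (n : ℝ) ^ (-2 * δ) * (((1 : ℕ+) : ℝ) ^ (-2 * σ) * density α σ)) := by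
    intro σ hσ
    have hσ : 0 < σ := hσ
    have hre' : ∀ t : ℝ, ((σ : ℂ) + t * Complex.I).re = σ := fun t => by simp
    have hd := density_nonneg hα hσ.le
    have h1 : ∑ m ∈ A, ‖b m‖ ^ 2 * (m : ℝ) ^ (-2 * σ) ≤
        ∑ n ∈ F, ‖a n‖ ^ 2 * (((n ^ M : ℕ+) : ℝ) ^ (-2 * σ) + (n : ℝ) ^ (-2 * δ)) := by
      by_cases hσδ : σ ≤ δ
      · refine (h.sum_coeff_map_poly_sq_le hΨ hΨΦ hre hF a hσ (η := M * σ) (fun t => ?_) A).trans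
          (Finset.sum_le_sum fun n _ => mul_le_mul_of_nonneg_left ?_ (sq_nonneg _))
        · have := hM (σ + t * Complex.I)
          rw [hre'] at this
          exact this hσ hσδ
        · have : ((n ^ M : ℕ+) : ℝ) ^ (-2 * σ) = (n : ℝ) ^ (-2 * (M * σ)) := by
            rw [PNat.pow_coe, Nat.cast_pow, ← Real.rpow_natCast, ← Real.rpow_mul (natCast_pos n).le]
            ring_nf
          rw [this]
          linarith [Real.rpow_nonneg (natCast_pos n).le (-2 * δ)]
      · refine (h.sum_coeff_map_poly_sq_le hΨ hΨΦ hre hF a hσ (η := σ) (fun t => ?_) A).trans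
          (Finset.sum_le_sum fun n _ => mul_le_mul_of_nonneg_left ?_ (sq_nonneg _))
        · have := hre (σ + t * Complex.I)
          rw [hre'] at this
          exact this hσ
        · have := Real.rpow_le_rpow_of_exponent_le (one_le_natCast n)
            (by linarith : -2 * σ ≤ -2 * δ)
          linarith [Real.rpow_nonneg (natCast_pos (n ^ M)).le (-2 * σ)]
    calc _ = (∑ m ∈ A, ‖b m‖ ^ 2 * (m : ℝ) ^ (-2 * σ)) * density α σ := by
          rw [Finset.sum_mul]
          exact Finset.sum_congr rfl fun m _ => by ring
      _ ≤ _ := mul_le_mul_of_nonneg_right h1 hd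
      _ = _ := by
          rw [Finset.sum_mul]
          refine Finset.sum_congr rfl fun n _ => ?_
          simp
          ring
  have hI := integrable_rpow_mul_density hα
  have hI' : ∀ n : ℕ+, MeasureTheory.IntegrableOn (fun σ : ℝ => ‖a n‖ ^ 2 *
      (((n ^ M : ℕ+) : ℝ) ^ (-2 * σ) * density α σ +
        (n : ℝ) ^ (-2 * δ) * (((1 : ℕ+) : ℝ) ^ (-2 * σ) * density α σ))) (Set.Ioi 0) := fun n =>
    ((hI (n ^ M)).add ((hI 1).const_mul _)).const_mul _
  have hl : ∑ m ∈ A, ‖b m‖ ^ 2 * weight α m =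
      ∫ σ in Set.Ioi (0 : ℝ), ∑ m ∈ A, ‖b m‖ ^ 2 * ((m : ℝ) ^ (-2 * σ) * density α σ) := by
    rw [MeasureTheory.integral_finsetSum _ fun m _ => (hI m).const_mul _]
    exact Finset.sum_congr rfl fun m _ => by
      rw [MeasureTheory.integral_const_mul, integral_eq_weight hα]
  have hr : ∑ n ∈ F, ‖a n‖ ^ 2 * (weight α (n ^ M) + (n : ℝ) ^ (-2 * δ)) =
      ∫ σ in Set.Ioi (0 : ℝ), ∑ n ∈ F, ‖a n‖ ^ 2 *
        (((n ^ M : ℕ+) : ℝ) ^ (-2 * σ) * density α σ +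
          (n : ℝ) ^ (-2 * δ) * (((1 : ℕ+) : ℝ) ^ (-2 * σ) * density α σ)) := by
    rw [MeasureTheory.integral_finsetSum _ fun n _ => hI' n]
    refine Finset.sum_congr rfl fun n _ => ?_
    rw [MeasureTheory.integral_const_mul, MeasureTheory.integral_add (hI (n ^ M))
      ((hI 1).const_mul _), MeasureTheory.integral_const_mul, integral_eq_weight hα,
      integral_eq_weight hα]
    simp [weight]
  rw [hl, hr]
  refine MeasureTheory.setIntegral_mono_on ?_ ?_ measurableSet_Ioi hpt
  · exact MeasureTheory.integrable_finsetSum _ fun m _ => (hI m).const_mul _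
  · exact MeasureTheory.integrable_finsetSum _ fun n _ => hI' n

end IsSmoothSymbol

/-- For `n ≥ 3`, `log n ≥ 1`, so `(1 + log n)/(1 + M log n) ≤ 2/M`. -/
lemma weight_pow_le {α : ℝ} (hα : -1 < α) {n : ℕ+} (hn : 3 ≤ (n : ℕ)) {M : ℕ} (hM : 1 ≤ M) :
    weight α (n ^ M) ≤ (2 / M : ℝ) ^ (α + 1) * weight α n := by
  have hM0 : (0 : ℝ) < M := by exact_mod_cast hM
  have hlog : 1 ≤ Real.log (n : ℝ) := by
    rw [Real.le_log_iff_exp_le (natCast_pos n)]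
    have h3 : (3 : ℝ) ≤ n := by exact_mod_cast hn
    linarith [Real.exp_one_lt_d9]
  rw [weight, weight, PNat.pow_coe, Nat.cast_pow, Real.log_pow, Real.rpow_neg (by positivity),
    Real.rpow_neg (by positivity), ← Real.inv_rpow (by positivity), ← Real.inv_rpow (by positivity),
    ← Real.mul_rpow (by positivity) (by positivity)]
  refine Real.rpow_le_rpow (by positivity) ?_ (by linarith)
  rw [← div_eq_mul_inv, div_div, inv_eq_one_div, div_le_div_iff₀ (by positivity) (by positivity)]
  nlinarith

/-- The order of quantifiers matters: `M` depends on `ε` alone, because `δ` will be obtained from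
`M` through the decay hypothesis. The power `n^{-2δ}` is then negligible against the logarithmic
weight for large `n`. -/
lemma exists_weight_pow_add_le {α : ℝ} (hα : -1 < α) {ε : ℝ} (hε : 0 < ε) :
    ∃ M : ℕ, 1 ≤ M ∧ ∀ δ : ℝ, 0 < δ → ∃ n₀ : ℕ, ∀ n : ℕ+, n₀ ≤ (n : ℕ) →
      weight α (n ^ M) + (n : ℝ) ^ (-2 * δ) ≤ ε * weight α n := by
  have hα1 : 0 < α + 1 := by linarith
  have h1 : Tendsto (fun M : ℕ => (2 / M : ℝ) ^ (α + 1)) atTop (𝓝 0) := by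
    have := (tendsto_const_div_atTop_nhds_zero_nat (2 : ℝ)).rpow_const (p := α + 1)
      (Or.inr hα1.le)
    rwa [Real.zero_rpow hα1.ne'] at this
  obtain ⟨M, hM, hM1⟩ := ((h1.eventually_lt_const (half_pos hε)).and (eventually_ge_atTop 1)).exists
  refine ⟨M, hM1, fun δ hδ => ?_⟩
  obtain ⟨C, hC, hk⟩ := exists_kern_le hα (half_lt_self hδ)
  have h2 : Tendsto (fun n : ℕ => C * (n : ℝ) ^ (-2 * (δ / 2))) atTop (𝓝 0) := by
    have := ((tendsto_rpow_neg_atTop hδ).comp tendsto_natCast_atTop_atTop).const_mul C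
    rw [mul_zero] at this
    refine this.congr fun n => ?_
    simp only [Function.comp_apply]
    ring_nf
  obtain ⟨n₁, hn₁⟩ := eventually_atTop.1 (h2.eventually_lt_const (half_pos hε))
  refine ⟨max n₁ 3, fun n hn => ?_⟩
  have hw := weight_pos α n
  have e1 := weight_pow_le hα ((le_max_right _ _).trans hn) hM1
  have e2 := (hk n).trans (hn₁ n ((le_max_left _ _).trans hn)).le
  rw [kern, ← div_eq_mul_inv, div_le_iff₀ hw] at e2
  nlinarith

/-- The preceding estimates bound `T` by `ε` on series starting at `n₀`, so `T` is within `ε` of the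
finite rank operator `T ∘L truncL F`. -/
theorem isCompactOperator_of_tendsto_re_div_re {α : ℝ} (hα : -1 < α) {c₀ N₀ : ℕ} {Φ Ψ : ℂ → ℂ}
    {T : Space α →L[ℂ] Space α} (h : ∀ N, N₀ ≤ N → IsSmoothSymbol α c₀ N Φ T)
    (hΨ : DifferentiableOn ℂ Ψ (halfPlane 0)) (hΨΦ : Set.EqOn Ψ Φ (halfPlane (1 / 2)))
    (hre : ∀ s : ℂ, 0 < s.re → s.re ≤ (Ψ s).re)
    (ht : Tendsto (fun s : ℂ => s.re / (Ψ s).re) reToZero (𝓝 0)) : IsCompactOperator T := by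
  have key : ∀ ε : ℝ, 0 < ε → ∃ F : Finset ℕ+, ‖T - T ∘L truncL F‖ ≤ ε := by
    intro ε hε
    obtain ⟨M, hM1, hM⟩ := exists_weight_pow_add_le hα (pow_pos hε 2)
    have hM0 : (0 : ℝ) < M := by exact_mod_cast hM1
    have hev := ht.eventually_lt_const (inv_pos.2 hM0)
    rw [reToZero, eventually_comap, eventually_nhdsWithin_iff] at hev
    obtain ⟨δ', hδ', hball⟩ := Metric.eventually_nhds_iff.1 hev
    have hMδ : ∀ s : ℂ, 0 < s.re → s.re ≤ δ' / 2 → M * s.re ≤ (Ψ s).re := by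
      intro s hs hsδ
      have h1 := hball (y := s.re) (by rw [Real.dist_eq, sub_zero, abs_of_pos hs]; linarith) hs s rfl
      rw [div_lt_iff₀ (hs.trans_le (hre s hs)), ← div_eq_inv_mul, lt_div_iff₀ hM0] at h1
      linarith
    obtain ⟨n₀, hn₀⟩ := hM (δ' / 2) (half_pos hδ')
    have hpoly : ∀ (F : Finset ℕ+) (a : ℕ+ → ℂ), (∀ n ∈ F, n₀ ≤ (n : ℕ)) →
        ‖T (poly α F a)‖ ≤ ε * ‖poly α F a‖ := by
      intro F a hF
      -- Any polynomial is smooth for a large enough `N`, and the norm estimate does not involve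
      -- `N`; hence the hypothesis `h` for all large `N`.
      set N := max N₀ (F.sup (fun n => (n : ℕ)) + 1) with hN
      have hsm : ∀ n ∈ F, n ∈ smoothSet N := fun n hn => IsSmoothSymbol.natCast_mem_smoothSet
        (lt_of_lt_of_le (Nat.lt_succ_of_le (Finset.le_sup (f := fun n : ℕ+ => (n : ℕ)) hn))
          (le_max_right _ _))
      have h1 := (h N (le_max_left _ _)).norm_map_poly_sq_le hΨ hΨΦ hre hMδ hsm a
      have h2 : ‖T (poly α F a)‖ ^ 2 ≤ (ε * ‖poly α F a‖) ^ 2 := by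
        refine h1.trans ?_
        rw [mul_pow, norm_sq_poly, Finset.mul_sum]
        refine Finset.sum_le_sum fun n hn => ?_
        have := mul_le_mul_of_nonneg_left (hn₀ n (hF n hn)) (sq_nonneg ‖a n‖)
        linarith
      exact abs_le_of_sq_le_sq' h2 (mul_nonneg hε.le (norm_nonneg _)) |>.2
    have htend : ∀ f : Space α, Tendsto (fun F => poly α F f.coeff) atTop (𝓝 f) := fun f => by
      rw [tendsto_iff_norm_sub_tendsto_zero]
      exact (tendsto_norm_sub_poly_coeff f).congr fun F => norm_sub_rev _ _
    set F₀ : Finset ℕ+ := Finset.Icc 1 ⟨n₀ + 1, by omega⟩ with hF₀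
    have hF₀' : ∀ n : ℕ+, n ∉ F₀ → n₀ ≤ (n : ℕ) := by
      intro n hn
      by_contra! hlt
      refine hn (Finset.mem_Icc.2 ⟨one_le, ?_⟩)
      change (n : ℕ) ≤ n₀ + 1
      omega
    refine ⟨F₀, ContinuousLinearMap.opNorm_le_bound _ hε.le fun f => ?_⟩
    have hval : (T - T ∘L truncL F₀) f = T (f - poly α F₀ f.coeff) := by
      rw [map_sub, ← truncL_apply]
      rfl
    rw [hval]
    set r := f - poly α F₀ f.coeff with hr
    have hr0 : ∀ F, ‖T (poly α F r.coeff)‖ ≤ ε * ‖poly α F r.coeff‖ := by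
      intro F
      classical
      have : poly α F r.coeff = poly α (F \ F₀) r.coeff := by
        ext n
        rw [coeff_poly, coeff_poly, hr, coeff_sub, coeff_poly]
        by_cases h1 : n ∈ F <;> by_cases h2 : n ∈ F₀ <;> simp [h1, h2]
      rw [this]
      exact hpoly _ _ fun n hn => hF₀' n (Finset.mem_sdiff.1 hn).2
    have h3 : ‖T r‖ ≤ ε * ‖r‖ :=
      le_of_tendsto_of_tendsto' ((T.continuous.tendsto r).comp (htend r)).norm
        ((htend r).norm.const_mul ε) hr0
    exact h3.trans (mul_le_mul_of_nonneg_left (norm_sub_poly_coeff_le F₀ f) hε.le)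
  have hmem : T ∈ closure {S : Space α →L[ℂ] Space α | IsCompactOperator S} := by
    rw [Metric.mem_closure_iff]
    intro ε hε
    obtain ⟨F, hF⟩ := key (ε / 2) (half_pos hε)
    refine ⟨T ∘L truncL F, (isCompactOperator_truncL F).clm_comp T, ?_⟩
    rw [dist_eq_norm]
    linarith
  rwa [isClosed_setOfPred_isCompactOperator.closure_eq] at hmem

/-! ### The counting function and its comparison with `Re s / Re Φ(s)` -/

lemma integral_sub_mul_rpow {α : ℝ} (hα : -1 < α) {σ : ℝ} (hσ : 0 ≤ σ) :
    ∫ u in (0 : ℝ)..σ, (σ - u) * u ^ α = σ ^ (α + 2) / ((α + 1) * (α + 2)) := by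
  have h1 : α + 1 ≠ 0 := by linarith
  have h2 : α + 2 ≠ 0 := by linarith
  have hi := intervalIntegral.intervalIntegrable_rpow' (a := 0) (b := σ) hα
  have hi' := intervalIntegral.intervalIntegrable_rpow' (a := 0) (b := σ)
    (show -1 < α + 1 by linarith)
  have heq : Set.EqOn (fun u : ℝ => (σ - u) * u ^ α) (fun u => σ * u ^ α - u ^ (α + 1))
      (Set.uIcc 0 σ) := by
    intro u hu
    rw [Set.uIcc_of_le hσ] at hu
    simp only
    rw [Real.rpow_add_one' hu.1 h1]
    ring
  rw [intervalIntegral.integral_congr heq, intervalIntegral.integral_sub (hi.const_mul σ) hi',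
    intervalIntegral.integral_const_mul, integral_rpow (Or.inl hα),
    integral_rpow (Or.inl (by linarith)), Real.zero_rpow h1, Real.zero_rpow (by linarith),
    show α + 1 + 1 = α + 2 by ring]
  have h3 : σ ^ (α + 2) = σ ^ (α + 1) * σ := by
    rw [← Real.rpow_add_one' hσ (by linarith)]
    congr 1
    ring
  rw [h3]
  field_simp
  ring

/-- Replace `e^{-2u}` by `1` from above and, on `[0, 1]`, by `e^{-2}` from below; the remaining
integral is explicit. -/
lemma exists_beta_bounds {α : ℝ} (hα : -1 < α) : ∃ c C : ℝ, 0 < c ∧ 0 < C ∧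
    (∀ σ, 0 < σ → σ ≤ 1 → c * σ ^ (α + 2) ≤ beta α σ) ∧
      ∀ σ, 0 < σ → beta α σ ≤ C * σ ^ (α + 2) := by
  set K : ℝ := 2 ^ (α + 1) / Real.Gamma (α + 1) with hK
  have hK0 : 0 < K := div_pos (Real.rpow_pos_of_pos two_pos _)
    (Real.Gamma_pos_of_pos (by linarith))
  set J : ℝ := ((α + 1) * (α + 2))⁻¹ with hJ
  have hJ0 : 0 < J := inv_pos.2 (mul_pos (by linarith) (by linarith))
  have hi : ∀ σ : ℝ, IntervalIntegrable (fun u : ℝ => (σ - u) * u ^ α) MeasureTheory.volume 0 σ :=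
    fun σ => (intervalIntegral.intervalIntegrable_rpow' hα).continuousOn_mul
      (continuous_const.sub continuous_id).continuousOn
  have hd : ∀ σ : ℝ, IntervalIntegrable (fun u : ℝ => (σ - u) * density α u)
      MeasureTheory.volume 0 σ := fun σ => by
    have hc : ContinuousOn (fun u : ℝ => K * Real.exp (-2 * u)) (Set.uIcc 0 σ) :=
      Continuous.continuousOn (by fun_prop)
    refine ((hi σ).continuousOn_mul hc).congr fun u _ => ?_
    simp only [density]
    ring
  refine ⟨K * Real.exp (-2) * J, K * J, by positivity, by positivity, fun σ hσ hσ1 => ?_,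
    fun σ hσ => ?_⟩
  · have h1 : K * Real.exp (-2) * J * σ ^ (α + 2) =
        ∫ u in (0 : ℝ)..σ, K * Real.exp (-2) * ((σ - u) * u ^ α) := by
      rw [intervalIntegral.integral_const_mul, integral_sub_mul_rpow hα hσ.le, hJ]
      ring
    rw [h1, beta]
    refine intervalIntegral.integral_mono_on hσ.le ((hi σ).const_mul _) (hd σ) fun u hu => ?_
    have h2 : Real.exp (-2) ≤ Real.exp (-2 * u) := Real.exp_le_exp.2 (by linarith [hu.2])
    have h3 : 0 ≤ K * ((σ - u) * u ^ α) :=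
      mul_nonneg hK0.le (mul_nonneg (by linarith [hu.2]) (Real.rpow_nonneg hu.1 _))
    have := mul_le_mul_of_nonneg_left h2 h3
    rw [density]
    linarith
  · have h1 : K * J * σ ^ (α + 2) = ∫ u in (0 : ℝ)..σ, K * ((σ - u) * u ^ α) := by
      rw [intervalIntegral.integral_const_mul, integral_sub_mul_rpow hα hσ.le, hJ]
      ring
    rw [h1, beta]
    refine intervalIntegral.integral_mono_on hσ.le (hd σ) ((hi σ).const_mul _) fun u hu => ?_
    have h2 : Real.exp (-2 * u) ≤ 1 := Real.exp_le_one_iff.2 (by linarith [hu.1])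
    have h3 : 0 ≤ K * ((σ - u) * u ^ α) :=
      mul_nonneg hK0.le (mul_nonneg (by linarith [hu.2]) (Real.rpow_nonneg hu.1 _))
    have := mul_le_mul_of_nonneg_left h2 h3
    rw [density]
    linarith

lemma eventually_reToZero_iff {p : ℂ → Prop} :
    (∀ᶠ s in reToZero, p s) ↔ ∃ δ > 0, ∀ s : ℂ, 0 < s.re → s.re < δ → p s := by
  rw [reToZero, eventually_comap, eventually_nhdsWithin_iff, Metric.eventually_nhds_iff]
  refine exists_congr fun δ => and_congr_right fun _ => ⟨fun h s hs hsδ => ?_, fun h x hx hx0 s hs => ?_⟩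
  · exact h (by rwa [Real.dist_eq, sub_zero, abs_of_pos hs]) hs s rfl
  · have hx0 : 0 < x := hx0
    rw [Real.dist_eq, sub_zero, abs_of_pos hx0] at hx
    exact h s (hs ▸ hx0) (hs ▸ hx)

/-- The point `a` is itself a preimage of `Ψ(a)`, so `β_α(Re a)` alone is bounded by the counting
function at `Ψ(a)`. -/
theorem tendsto_of_nevanlinna_le {α : ℝ} (hα : -1 < α) {Ψ : ℂ → ℂ}
    (hmaps : ∀ s : ℂ, 0 < s.re → 0 < (Ψ s).re)
    (h : ∀ ε : ℝ, 0 < ε → ∀ᶠ s in reToZero,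
      nevanlinna α Ψ s ≤ ENNReal.ofReal (ε * s.re ^ (α + 2))) :
    Tendsto (fun s : ℂ => s.re / (Ψ s).re) reToZero (𝓝 0) := by
  obtain ⟨c, -, hc, -, hβ, -⟩ := exists_beta_bounds hα
  rw [Metric.tendsto_nhds]
  intro ε hε
  have hα2 : 0 < α + 2 := by linarith
  have hεα : 0 < ε ^ (α + 2) := Real.rpow_pos_of_pos hε _
  obtain ⟨δ, hδ, hN⟩ := eventually_reToZero_iff.1 (h (c * ε ^ (α + 2) / 2) (by positivity))
  -- The bound `1` is for the lower estimate of `β_α`; `ε δ` makes `Re Ψ(a) < δ` in the case to be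
  -- refuted, `ε Re Ψ(a) ≤ Re a`.
  refine eventually_reToZero_iff.2 ⟨min 1 (ε * δ), by positivity, fun a ha haδ => ?_⟩
  have hP := hmaps a ha
  rw [Real.dist_eq, sub_zero, abs_of_pos (div_pos ha hP), div_lt_iff₀ hP]
  by_contra! hle
  have hlt : (Ψ a).re < δ := by
    have := haδ.trans_le (min_le_right _ _)
    exact lt_of_mul_lt_mul_left (hle.trans_lt this) hε.le
  have h1 := hN (Ψ a) hP hlt
  have h2 : ENNReal.ofReal (beta α a.re) ≤ nevanlinna α Ψ (Ψ a) :=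
    ENNReal.le_tsum (f := fun b : {b : ℂ // b ∈ halfPlane 0 ∧ Ψ b = Ψ a} =>
      ENNReal.ofReal (beta α (b : ℂ).re)) ⟨a, ha, rfl⟩
  have hPα : 0 < (Ψ a).re ^ (α + 2) := Real.rpow_pos_of_pos hP _
  have h3 := (ENNReal.ofReal_le_ofReal_iff (by positivity)).1 (h2.trans h1)
  have h4 := (hβ a.re ha (haδ.le.trans (min_le_left _ _))).trans h3
  have h5 : (ε * (Ψ a).re) ^ (α + 2) ≤ a.re ^ (α + 2) :=
    Real.rpow_le_rpow (by positivity) hle hα2.le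
  rw [Real.mul_rpow hε.le hP.le] at h5
  have h6 := mul_le_mul_of_nonneg_left h5 hc.le
  have h7 : 0 < c * (ε ^ (α + 2) * (Ψ a).re ^ (α + 2)) := by positivity
  linarith

lemma add_conj_ne_zero {z a : ℂ} (hz : 0 < z.re) (ha : 0 < a.re) :
    z + (starRingEnd ℂ) a ≠ 0 := fun h => by
  have := congrArg Complex.re h
  simp at this
  linarith

lemma norm_sq_sub_div {z a : ℂ} (hz : 0 < z.re) (ha : 0 < a.re) :
    ‖(z - a) / (z + (starRingEnd ℂ) a)‖ ^ 2 =
      1 - 4 * z.re * a.re / ‖z + (starRingEnd ℂ) a‖ ^ 2 := by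
  have h0 : ‖z + (starRingEnd ℂ) a‖ ^ 2 ≠ 0 :=
    pow_ne_zero 2 (norm_ne_zero_iff.2 (add_conj_ne_zero hz ha))
  rw [norm_div, div_pow, eq_sub_iff_add_eq, ← add_div, div_eq_one_iff_eq h0,
    ← Complex.normSq_eq_norm_sq, ← Complex.normSq_eq_norm_sq, Complex.normSq_apply,
    Complex.normSq_apply]
  simp
  ring

/-- Dividing out a zero of a function on the right half-plane bounded by `1`. -/
lemma exists_eq_blaschke_mul {g : ℂ → ℂ} (hg : DifferentiableOn ℂ g (halfPlane 0))
    (hb : ∀ z ∈ halfPlane 0, ‖g z‖ ≤ 1) {a : ℂ} (ha : a ∈ halfPlane 0) (hga : g a = 0) :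
    ∃ g₁ : ℂ → ℂ, DifferentiableOn ℂ g₁ (halfPlane 0) ∧ (∀ z ∈ halfPlane 0, ‖g₁ z‖ ≤ 1) ∧
      ∀ z ∈ halfPlane 0, g z = (z - a) / (z + (starRingEnd ℂ) a) * g₁ z := by
  have ha0 : 0 < a.re := ha
  -- `τ` inverts the Blaschke factor `b` and sends `0` to `a`; the claim becomes the Schwarz lemma
  -- for `g ∘ τ`.
  set τ : ℂ → ℂ := fun w => (a + (starRingEnd ℂ) a * w) / (1 - w) with hτ
  set b : ℂ → ℂ := fun z => (z - a) / (z + (starRingEnd ℂ) a) with hbdef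
  have h1w : ∀ w ∈ Metric.ball (0 : ℂ) 1, 1 - w ≠ 0 := fun w hw h => by
    rw [← sub_eq_zero.1 h] at hw
    simp at hw
  have hτm : ∀ w ∈ Metric.ball (0 : ℂ) 1, τ w ∈ halfPlane 0 := by
    intro w hw
    have hw1 : ‖w‖ < 1 := by simpa using hw
    have hns : 0 < Complex.normSq (1 - w) := Complex.normSq_pos.2 (h1w w hw)
    have hre : (τ w).re = a.re * (1 - ‖w‖ ^ 2) / Complex.normSq (1 - w) := by
      rw [hτ, Complex.div_re, ← add_div, ← Complex.normSq_eq_norm_sq, Complex.normSq_apply w]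
      congr 1
      simp
      ring
    change 0 < (τ w).re
    rw [hre]
    have : 0 < 1 - ‖w‖ ^ 2 := by nlinarith [norm_nonneg w]
    positivity
  have hbm : ∀ z ∈ halfPlane 0, b z ∈ Metric.ball (0 : ℂ) 1 := by
    intro z hz
    have hz0 : 0 < z.re := hz
    have h1 := norm_sq_sub_div hz0 ha0
    have h2 : 0 < ‖z + (starRingEnd ℂ) a‖ := norm_pos_iff.2 (add_conj_ne_zero hz0 ha0)
    have h3 : 0 < 4 * z.re * a.re / ‖z + (starRingEnd ℂ) a‖ ^ 2 := by positivity
    rw [mem_ball_zero_iff]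
    change ‖(z - a) / (z + (starRingEnd ℂ) a)‖ < 1
    nlinarith [norm_nonneg ((z - a) / (z + (starRingEnd ℂ) a))]
  have hτb : ∀ z ∈ halfPlane 0, τ (b z) = z := by
    intro z hz
    have h1 := add_conj_ne_zero (show 0 < z.re from hz) ha0
    have h2 := add_conj_ne_zero ha0 ha0
    have h3 := h1w (b z) (hbm z hz)
    rw [hτ]
    simp only
    rw [div_eq_iff h3, hbdef]
    field_simp
    ring
  have hbd : DifferentiableOn ℂ b (halfPlane 0) := by
    refine DifferentiableOn.div (by fun_prop) (by fun_prop) fun z hz => ?_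
    exact add_conj_ne_zero hz ha0
  have hτd : DifferentiableOn ℂ τ (Metric.ball 0 1) :=
    DifferentiableOn.div (by fun_prop) (by fun_prop) h1w
  set f : ℂ → ℂ := g ∘ τ with hf
  have hfd : DifferentiableOn ℂ f (Metric.ball 0 1) := hg.comp hτd hτm
  have hf0 : f 0 = 0 := by simp [hf, hτ, hga]
  refine ⟨fun z => dslope f 0 (b z), ?_, fun z hz => ?_, fun z hz => ?_⟩
  · exact ((Complex.differentiableOn_dslope (Metric.ball_mem_nhds 0 one_pos)).2 hfd).comp hbd hbm
  · have := Complex.norm_dslope_le_div_of_mapsTo_ball (R₂ := 1) hfd (fun w hw => by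
      rw [hf0, mem_closedBall_zero_iff]
      exact hb _ (hτm w hw)) (hbm z hz)
    simpa using this
  · have := sub_smul_dslope f 0 (b z)
    rw [hf0, sub_zero, sub_zero, smul_eq_mul, hf, Function.comp_apply, hτb z hz] at this
    exact this.symm

/-- Divide out one zero at a time: a Blaschke factor vanishes only at its own point, so the other
points of `S` remain zeros of the quotient. -/
lemma norm_le_prod_blaschke (S : Finset ℂ) : ∀ {g : ℂ → ℂ}, DifferentiableOn ℂ g (halfPlane 0) →
    (∀ z ∈ halfPlane 0, ‖g z‖ ≤ 1) → (∀ a ∈ S, a ∈ halfPlane 0 ∧ g a = 0) →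
    ∀ z ∈ halfPlane 0, ‖g z‖ ≤ ∏ a ∈ S, ‖(z - a) / (z + (starRingEnd ℂ) a)‖ := by
  classical
  induction S using Finset.induction_on with
  | empty => intro g _ hb _ z hz; simpa using hb z hz
  | insert a S haS ih =>
    intro g hg hb hS z hz
    obtain ⟨ha, hga⟩ := hS a (Finset.mem_insert_self a S)
    obtain ⟨g₁, hg₁, hb₁, hgg₁⟩ := exists_eq_blaschke_mul hg hb ha hga
    rw [Finset.prod_insert haS, hgg₁ z hz, norm_mul]
    refine mul_le_mul_of_nonneg_left (ih hg₁ hb₁ (fun a' ha' => ?_) z hz) (norm_nonneg _)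
    obtain ⟨h1, h2⟩ := hS a' (Finset.mem_insert_of_mem ha')
    refine ⟨h1, ?_⟩
    rw [hgg₁ a' h1] at h2
    refine (mul_eq_zero.1 h2).resolve_left (div_ne_zero (sub_ne_zero.2 ?_)
      (add_conj_ne_zero h1 ha))
    rintro rfl
    exact haS ha'

/-- A Littlewood-type inequality for the preimages of a point. -/
lemma sum_re_le {c₀ : ℕ} (hc₀ : 1 ≤ c₀) {Ψ : ℂ → ℂ} (hΨ : DifferentiableOn ℂ Ψ (halfPlane 0))
    (hre : ∀ s : ℂ, 0 < s.re → s.re ≤ (Ψ s).re) {A : ℝ}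
    (hA : ∀ s ∈ halfPlane 0, |(Ψ s - c₀ * s).im| ≤ A) {s : ℂ} (hs : 0 < s.re) (hs1 : s.re ≤ 1 / 8)
    (S : Finset ℂ) (hS : ∀ a ∈ S, a ∈ halfPlane 0 ∧ Ψ a = s) :
    ∑ a ∈ S, a.re ≤ 2 * (4 + A ^ 2) * s.re := by
  have hc : (1 : ℝ) ≤ c₀ := by exact_mod_cast hc₀
  have hP : ∀ w : ℂ, 0 < w.re → 0 < (Ψ w).re := fun w hw => hw.trans_le (hre w hw)
  -- The point where the Blaschke estimate is read off. Boundedness of `Im φ` puts every preimage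
  -- within height `A` of it, which gives `|z + conj a|² ≤ 4 + A²`, uniformly in `Im s`.
  set z : ℂ := ⟨1, s.im / c₀⟩ with hz
  have hz0 : 0 < z.re := one_pos
  set D := 4 + A ^ 2 with hD
  have hD0 : 0 < D := by positivity
  set g : ℂ → ℂ := fun w => (Ψ w - s) / (Ψ w + (starRingEnd ℂ) s) with hg
  have hgd : DifferentiableOn ℂ g (halfPlane 0) :=
    (hΨ.sub_const _).div (hΨ.add_const _) fun w hw => add_conj_ne_zero (hP w hw) hs
  have hgsq : ∀ w : ℂ, 0 < w.re → ‖g w‖ ^ 2 =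
      1 - 4 * (Ψ w).re * s.re / ‖Ψ w + (starRingEnd ℂ) s‖ ^ 2 := fun w hw =>
    norm_sq_sub_div (hP w hw) hs
  have hgb : ∀ w ∈ halfPlane 0, ‖g w‖ ≤ 1 := by
    intro w hw
    have h1 := hgsq w hw
    have h2 : 0 ≤ 4 * (Ψ w).re * s.re / ‖Ψ w + (starRingEnd ℂ) s‖ ^ 2 := by
      have := hP w hw
      positivity
    nlinarith [norm_nonneg (g w)]
  have hprod := norm_le_prod_blaschke S hgd hgb
    (fun a ha => ⟨(hS a ha).1, by simp [hg, (hS a ha).2]⟩) z hz0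
  have hle : ∀ a ∈ S, ‖(z - a) / (z + (starRingEnd ℂ) a)‖ ^ 2 ≤ Real.exp (-(4 * a.re / D)) := by
    intro a ha
    obtain ⟨ha0, hΨa⟩ := hS a ha
    have ha0 : 0 < a.re := ha0
    have hn : ‖z + (starRingEnd ℂ) a‖ ^ 2 ≤ D := by
      have h1 : a.re ≤ 1 := by
        have := hre a ha0
        rw [hΨa] at this
        linarith
      have h2 := hA a ha0
      rw [hΨa] at h2
      have h3 : (s - c₀ * a).im = c₀ * (s.im / c₀ - a.im) := by
        simp
        field_simp
      rw [h3, abs_mul, abs_of_nonneg (by linarith : (0 : ℝ) ≤ c₀)] at h2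
      have h4 : |s.im / c₀ - a.im| ≤ A := by
        nlinarith [abs_nonneg (s.im / c₀ - a.im)]
      have h5 := sq_le_sq' (by linarith [(abs_le.1 h4).1]) (abs_le.1 h4).2
      rw [← Complex.normSq_eq_norm_sq, Complex.normSq_apply]
      simp only [Complex.add_re, Complex.add_im, Complex.conj_re, Complex.conj_im, hz]
      nlinarith
    have hn0 : 0 < ‖z + (starRingEnd ℂ) a‖ ^ 2 :=
      pow_pos (norm_pos_iff.2 (add_conj_ne_zero hz0 ha0)) 2
    rw [norm_sq_sub_div hz0 ha0]
    have h6 : 4 * a.re / D ≤ 4 * z.re * a.re / ‖z + (starRingEnd ℂ) a‖ ^ 2 := by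
      rw [show 4 * z.re * a.re = 4 * a.re by simp [hz]]
      exact div_le_div_of_nonneg_left (by positivity) hn0 hn
    have h7 := Real.add_one_le_exp (-(4 * a.re / D))
    linarith
  have hX : ‖g z‖ ^ 2 ≤ Real.exp (-(4 * ∑ a ∈ S, a.re) / D) := by
    calc ‖g z‖ ^ 2 ≤ (∏ a ∈ S, ‖(z - a) / (z + (starRingEnd ℂ) a)‖) ^ 2 :=
          pow_le_pow_left₀ (norm_nonneg _) hprod 2
      _ = ∏ a ∈ S, ‖(z - a) / (z + (starRingEnd ℂ) a)‖ ^ 2 := (Finset.prod_pow _ _ _).symm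
      _ ≤ ∏ a ∈ S, Real.exp (-(4 * a.re / D)) :=
          Finset.prod_le_prod (fun _ _ => sq_nonneg _) hle
      _ = _ := by
          rw [← Real.exp_sum, Finset.sum_neg_distrib, ← Finset.sum_div, ← Finset.mul_sum, neg_div]
  set y := 4 * (Ψ z).re * s.re / ‖Ψ z + (starRingEnd ℂ) s‖ ^ 2 with hy
  have hPz : 1 ≤ (Ψ z).re := hre z hz0
  have hy0 : 0 ≤ y := by positivity
  -- From `Re Ψ(z) ≥ 1`. As `Re s ≤ 1/8`, also `y ≤ 1/2`, which is exactly what `e^{-2y} ≤ 1 - y`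
  -- needs below through `(1 - y)(1 + 2y) ≥ 1`.
  have hy1 : y ≤ 4 * s.re := by
    have h1 : (Ψ z).re ^ 2 ≤ ‖Ψ z + (starRingEnd ℂ) s‖ ^ 2 := by
      rw [← Complex.normSq_eq_norm_sq, Complex.normSq_apply]
      simp only [Complex.add_re, Complex.conj_re]
      nlinarith [mul_self_nonneg (Ψ z + (starRingEnd ℂ) s).im]
    rw [hy, div_le_iff₀ (lt_of_lt_of_le (by positivity) h1)]
    have h2 : (Ψ z).re ≤ ‖Ψ z + (starRingEnd ℂ) s‖ ^ 2 := by nlinarith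
    nlinarith [mul_le_mul_of_nonneg_left h2 hs.le]
  have hexp : Real.exp (-(2 * y)) ≤ 1 - y := by
    rw [Real.exp_neg, inv_le_comm₀ (Real.exp_pos _) (by linarith)]
    refine le_trans ?_ (Real.add_one_le_exp (2 * y))
    rw [inv_le_iff_one_le_mul₀ (by linarith)]
    nlinarith
  have h8 := Real.exp_le_exp.1 (hexp.trans ((hgsq z hz0).symm.trans_le hX))
  have h9 : 4 * ∑ a ∈ S, a.re ≤ 2 * y * D := by
    rw [neg_div, neg_le_neg_iff, div_le_iff₀ hD0] at h8
    exact h8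
  nlinarith

/-- Split `(Re a)^{α+2} = (Re a)^{α+1} Re a`. Each preimage has `Re a ≤ Re s`, so the decay
hypothesis applies at `a` and gives `Re a ≤ η Re s` for the first factor, with `α + 1 > 0`;
`sum_re_le` sums the second. -/
theorem nevanlinna_le_of_tendsto {α : ℝ} (hα : -1 < α) {c₀ : ℕ} (hc₀ : 1 ≤ c₀) {Ψ : ℂ → ℂ}
    (hΨ : DifferentiableOn ℂ Ψ (halfPlane 0)) (hre : ∀ s : ℂ, 0 < s.re → s.re ≤ (Ψ s).re)
    {A : ℝ} (hA : ∀ s ∈ halfPlane 0, |(Ψ s - c₀ * s).im| ≤ A)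
    (ht : Tendsto (fun s : ℂ => s.re / (Ψ s).re) reToZero (𝓝 0)) {ε : ℝ} (hε : 0 < ε) :
    ∀ᶠ s in reToZero, nevanlinna α Ψ s ≤ ENNReal.ofReal (ε * s.re ^ (α + 2)) := by
  obtain ⟨-, C, -, hC, -, hβ⟩ := exists_beta_bounds hα
  have hα1 : 0 < α + 1 := by linarith
  set E := C * (2 * (4 + A ^ 2)) with hE
  have hE0 : 0 < E := by positivity
  set η := (ε / E) ^ (α + 1)⁻¹ with hη
  have hη0 : 0 < η := Real.rpow_pos_of_pos (by positivity) _
  have hηE : η ^ (α + 1) * E = ε := by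
    rw [hη, ← Real.rpow_mul (by positivity), inv_mul_cancel₀ hα1.ne', Real.rpow_one,
      div_mul_cancel₀ _ hE0.ne']
  obtain ⟨δ, hδ, hlt⟩ := eventually_reToZero_iff.1 (ht.eventually_lt_const hη0)
  refine eventually_reToZero_iff.2 ⟨min δ (1 / 8), by positivity, fun s hs hsδ => ?_⟩
  rw [nevanlinna, ENNReal.tsum_eq_iSup_sum]
  refine iSup_le fun S => ?_
  have hmem : ∀ a : {a : ℂ // a ∈ halfPlane 0 ∧ Ψ a = s}, 0 < (a : ℂ).re ∧ (a : ℂ).re ≤ η * s.re := by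
    rintro ⟨a, ha, hΨa⟩
    have ha0 : 0 < a.re := ha
    have h1 := hre a ha0
    rw [hΨa] at h1
    have h2 := hlt a ha0 (h1.trans_lt (hsδ.trans_le (min_le_left _ _)))
    rw [hΨa, div_lt_iff₀ hs] at h2
    exact ⟨ha0, h2.le⟩
  have hsum := sum_re_le hc₀ hΨ hre hA hs (hsδ.le.trans (min_le_right _ _))
    (S.map (Function.Embedding.subtype _)) (fun a ha => by
      obtain ⟨b, -, rfl⟩ := Finset.mem_map.1 ha
      exact b.2)
  rw [Finset.sum_map] at hsum
  simp only [Function.Embedding.subtype_apply] at hsum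
  calc ∑ a ∈ S, ENNReal.ofReal (beta α (a : ℂ).re)
      ≤ ∑ a ∈ S, ENNReal.ofReal (C * (η * s.re) ^ (α + 1) * (a : ℂ).re) := by
        refine Finset.sum_le_sum fun a _ => ENNReal.ofReal_le_ofReal ?_
        obtain ⟨h1, h2⟩ := hmem a
        refine (hβ _ h1).trans ?_
        rw [show α + 2 = α + 1 + 1 by ring, Real.rpow_add_one h1.ne', ← mul_assoc]
        refine mul_le_mul_of_nonneg_right (mul_le_mul_of_nonneg_left
          (Real.rpow_le_rpow h1.le h2 hα1.le) hC.le) h1.le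
    _ = ENNReal.ofReal (C * (η * s.re) ^ (α + 1) * ∑ a ∈ S, (a : ℂ).re) := by
        rw [Finset.mul_sum, ENNReal.ofReal_sum_of_nonneg fun a _ =>
          mul_nonneg (mul_nonneg hC.le (Real.rpow_nonneg (by positivity) _)) (hmem a).1.le]
    _ ≤ _ := by
        refine ENNReal.ofReal_le_ofReal ?_
        refine (mul_le_mul_of_nonneg_left hsum
          (mul_nonneg hC.le (Real.rpow_nonneg (by positivity) _))).trans_eq ?_
        have h3 : s.re ^ (α + 2) = s.re ^ (α + 1) * s.re := by
          rw [← Real.rpow_add_one hs.ne']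
          congr 1
          ring
        rw [Real.mul_rpow hη0.le hs.le, ← hηE, hE, h3]
        ring

/-! ### Assembly of the theorem -/

lemma IsSymbol.isSmoothSymbol {α : ℝ} (hα : -1 < α) {c₀ l : ℕ} {c : ℕ+ → ℂ} {Φ : ℂ → ℂ}
    (hΦ : IsSymbol α c₀ c Φ) (hc : SmoothSupported l c) {T : Space α →L[ℂ] Space α}
    (hT : IsCompositionOperator α Φ T) {N : ℕ} (hN : l < N) : IsSmoothSymbol α c₀ N Φ T where
  neg_one_lt := hα
  differentiableOn := hΦ.analytic
  isCompositionOperator := hT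
  coeff_support n hn m hm := by
    refine mem_smoothSet_of_coeff_map_monomial_ne_zero hα hΦ.dirichlet hT (fun d hd => ?_) hn m hm
    refine Nat.mem_smoothNumbers'.2 fun p hp hpd => ?_
    by_contra! hpN
    exact hd (hc d ⟨p, hp, hpd, hN.trans_le hpN⟩)

end DirichletBergman

end

theorem mainTheorem3 (α : ℝ) (hα : -1 < α) (c₀ l : ℕ) (hc₀ : 1 ≤ c₀) (hl : 1 ≤ l)
    (c : ℕ+ → ℂ) (Φ : ℂ → ℂ) (hΦ : DirichletBergman.IsSymbol α c₀ c Φ)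
    (hc : DirichletBergman.SmoothSupported l c) :
    ∃ Ψ : ℂ → ℂ,
      DifferentiableOn ℂ Ψ (DirichletBergman.halfPlane 0) ∧
      Set.EqOn Ψ Φ (DirichletBergman.halfPlane (1 / 2)) ∧
      Set.MapsTo Ψ (DirichletBergman.halfPlane 0) (DirichletBergman.halfPlane 0) ∧
      ((∃ A : ℝ, ∀ s ∈ DirichletBergman.halfPlane 0, |(Ψ s - c₀ * s).im| ≤ A) →
        List.TFAE [
          DirichletBergman.CompactComposition α Φ,
          Filter.Tendsto (fun s : ℂ => s.re / (Ψ s).re) DirichletBergman.reToZero (nhds 0),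
          ∀ ε : ℝ, 0 < ε → ∀ᶠ s in DirichletBergman.reToZero,
            DirichletBergman.nevanlinna α Ψ s ≤ ENNReal.ofReal (ε * s.re ^ (α + 2))]) := by
  obtain ⟨T, hT⟩ := hΦ.bounded
  -- Stated for every operator `S` representing `C_Φ`, since the compact one in (i) is not given as
  -- `T`. The level `l + 4` exceeds `l` and makes `2` and `3` smooth.
  have hsm : ∀ {S : DirichletBergman.Space α →L[ℂ] DirichletBergman.Space α},
      DirichletBergman.IsCompositionOperator α Φ S →
      ∀ N, l + 4 ≤ N → DirichletBergman.IsSmoothSymbol α c₀ N Φ S := fun hS N hN =>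
    hΦ.isSmoothSymbol hα hc hS (by omega)
  have h := hsm hT (l + 4) le_rfl
  obtain ⟨Ψ, hΨ, hΨΦ⟩ := h.exists_extension (by omega)
  have hre : ∀ s : ℂ, 0 < s.re → s.re ≤ (Ψ s).re := fun s hs => by
    have h1 := h.mul_re_le_re (by omega) hΨ hΨΦ hs
    have h2 : (1 : ℝ) ≤ c₀ := by exact_mod_cast hc₀
    nlinarith
  have hmaps : ∀ s : ℂ, 0 < s.re → 0 < (Ψ s).re := fun s hs => hs.trans_le (hre s hs)
  refine ⟨Ψ, hΨ, hΨΦ, hmaps, ?_⟩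
  rintro ⟨A, hA⟩
  tfae_have 1 → 2 := by
    rintro ⟨S, hS, hcomp⟩
    exact (hsm hS (l + 4) le_rfl).tendsto_of_isCompactOperator (by omega) hΨ hΨΦ hmaps hcomp
  tfae_have 2 → 1 := fun ht => ⟨T, hT,
    DirichletBergman.isCompactOperator_of_tendsto_re_div_re hα (hsm hT) hΨ hΨΦ hre ht⟩
  tfae_have 2 → 3 := fun ht ε hε =>
    DirichletBergman.nevanlinna_le_of_tendsto hα hc₀ hΨ hre hA ht hε
  tfae_have 3 → 2 := DirichletBergman.tendsto_of_nevanlinna_le hα hmaps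
  tfae_finish
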